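/- Let $Z\leftarrow N_Z$, $X\leftarrow BZ+N_X$, $Y\leftarrow Z^\top\gamma+X^\top\alpha+N_Y$ be a linear structural equation model with $Z\in\mathbb R^d$, $X\in\mathbb R^p$, $Y\in\mathbb R$ and independent noises $N_Z\sim\mathcal N(0,\Sigma_Z)$, $N_X\sim\mathcal N(0,\Sigma_X)$, $N_Y\sim\mathcal N(0,\sigma_Y^2)$, where $\Sigma_X+B\Sigma_ZB^\top$ is non-singular; it defines the observational distribution of $(X,Y)$. The interventional distribution of $(X,Y)$ arises by replacing the assignment of $X$ by $X\leftarrow\widetilde N_X$, where $\widetilde N_X$ is independent of $(N_Z,N_Y)$ and has a law (not necessarily Gaussian) that is not concentrated on a proper linear subspace of $\mathbb R^p$ (for instance, a centred law with positive definite covariance matrix). For each $m$, let $(X_O,Y_O)$ with $X_O\in\mathbb R^{n\times p}$, $Y_O\in\mathbb R^n$, $n=n(m)$, and $(X_I,Y_I)$ with $X_I\in\mathbb R^{m\times p}$, $Y_I\in\mathbb R^m$ be independent i.i.d. samples of $(X,Y)$ from the observational and the interventional distribution. Put $$\hat\alpha_O=(X_O^\top X_O)^{-1}X_O^\top Y_O,\qquad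 \hat\alpha_I=(X_I^\top X_I)^{-1}X_I^\top Y_I,$$ $$\hat C_O=\frac{\lVert Y_O-X_O\hat\alpha_O\rVert_2^2}{n-1}(X_O^\top X_O)^{-1},\qquad \hat C_I=\frac{\lVert Y_I-X_I\hat\alpha_I\rVert_2^2}{m-1}(X_I^\top X_I)^{-1},$$ where the inverse of a singular moment matrix, and division by zero, is read as $0$. For fixed $\lambda>0$ and $\varepsilon>0$ (independent of $m$ and of the data), let $$\hat\Delta=\operatorname*{arg\,min}_{\Delta\in\mathbb R^p}\Big\{\lVert (Y_I-X_I\hat\alpha_O)+X_I\Delta\rVert_2^2+\lambda\lVert\Delta\rVert_2^2\Big\},$$ $$\hat W=\big(\hat C_O+\hat\Delta\hat\Delta^\top+\varepsilon I_p\big)\big(\hat C_I+\hat C_O+\hat\Delta\hat\Delta^\top+\varepsilon I_p\big)^{-1},\qquad \hat\alpha_{\hat W}=\hat W\hat\alpha_I+(I_p-\hat W)\hat\alpha_O.$$ If $n(m)\to\infty$ and $n(m)/m\to c$ as $m\to\infty$ for some real number $c$ (the first condition being automatic when $c>0$), then $$\lim_{m\to\infty}\mathbb E\big[\lVert\hat\alpha_{\hat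 W}-\alpha\rVert_2^2\big]=0;$$ in particular, this mean squared error is finite for all large $m$. -/

import Mathlib

open MeasureTheory ProbabilityTheory Filter Topology Matrix
open scoped NNReal ENNReal

namespace CausalShrinkage

/-! ### Estimators computed from a data set

A data set of size `k` is a design matrix `X` (one row per observation) together with a vector `Y`
of outcomes.  Vectors of `ℝ^p` are functions `Fin p → ℝ`; Euclidean norms are written through
`sqNorm`. -/

/-- The squared Euclidean norm `‖v‖₂²`. -/
def sqNorm {ι : Type*} [Fintype ι] (v : ι → ℝ) : ℝ := ∑ i, v i ^ 2

/-- The ordinary least squares estimator `(XᵀX)⁻¹ Xᵀ Y`. -/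
noncomputable def ols {k p : ℕ} (X : Matrix (Fin k) (Fin p) ℝ) (Y : Fin k → ℝ) : Fin p → ℝ :=
  (Xᵀ * X)⁻¹ *ᵥ (Xᵀ *ᵥ Y)

/-- The residual variance estimator `‖Y - X α̂‖₂² / (k - 1)` of the least squares fit `α̂`. -/
noncomputable def varHat {k p : ℕ} (X : Matrix (Fin k) (Fin p) ℝ) (Y : Fin k → ℝ) : ℝ :=
  1 / ((k : ℝ) - 1) * sqNorm (Y - X *ᵥ ols X Y)

/-- The standard estimator `(XᵀX)⁻¹ σ̂²` of the covariance matrix of the least squares estimator. -/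
noncomputable def covHat {k p : ℕ} (X : Matrix (Fin k) (Fin p) ℝ) (Y : Fin k → ℝ) :
    Matrix (Fin p) (Fin p) ℝ :=
  varHat X Y • (Xᵀ * X)⁻¹

/-- The ridge objective `Δ ↦ ‖r + X Δ‖₂² + lam ‖Δ‖₂²`. -/
def ridgeObjective {k p : ℕ} (lam : ℝ) (X : Matrix (Fin k) (Fin p) ℝ) (r : Fin k → ℝ)
    (Δ : Fin p → ℝ) : ℝ :=
  sqNorm (r + X *ᵥ Δ) + lam * sqNorm Δ

/-- `argmin_Δ ‖r + X Δ‖₂² + lam ‖Δ‖₂²`.  For `lam > 0` the minimizer exists and is unique, see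
`isMinOn_ridgeObjective_iff`. -/
noncomputable def ridgeArgmin {k p : ℕ} (lam : ℝ) (X : Matrix (Fin k) (Fin p) ℝ)
    (r : Fin k → ℝ) : Fin p → ℝ :=
  Classical.epsilon fun Δ => IsMinOn (ridgeObjective lam X r) Set.univ Δ

theorem sqNorm_eq_dotProduct {ι : Type*} [Fintype ι] (v : ι → ℝ) : sqNorm v = v ⬝ᵥ v := by
  simp [sqNorm, dotProduct, sq]

theorem sqNorm_nonneg {ι : Type*} [Fintype ι] (v : ι → ℝ) : 0 ≤ sqNorm v :=
  Finset.sum_nonneg fun _ _ => sq_nonneg _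

theorem posDef_ridge {k p : ℕ} {lam : ℝ} (hlam : 0 < lam) (X : Matrix (Fin k) (Fin p) ℝ) :
    (Xᵀ * X + lam • (1 : Matrix (Fin p) (Fin p) ℝ)).PosDef := by
  have h1 : (Xᵀ * X).PosSemidef := by
    simpa [conjTranspose_eq_transpose_of_trivial] using posSemidef_conjTranspose_mul_self X
  exact PosDef.posSemidef_add h1 (PosDef.one.smul hlam)

/-- At a solution `Δ₀` of the normal equations the ridge objective expands exactly. -/
theorem ridgeObjective_expand {k p : ℕ} (lam : ℝ) (X : Matrix (Fin k) (Fin p) ℝ)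
    (r : Fin k → ℝ) (Δ₀ Δ : Fin p → ℝ)
    (h : (Xᵀ * X + lam • (1 : Matrix (Fin p) (Fin p) ℝ)) *ᵥ Δ₀ = -(Xᵀ *ᵥ r)) :
    ridgeObjective lam X r Δ =
      ridgeObjective lam X r Δ₀ + sqNorm (X *ᵥ (Δ - Δ₀)) + lam * sqNorm (Δ - Δ₀) := by
  obtain ⟨e, rfl⟩ : ∃ e, Δ = Δ₀ + e := ⟨Δ - Δ₀, by abel⟩
  have h2 : e ⬝ᵥ (Xᵀ *ᵥ (X *ᵥ Δ₀)) + lam * (e ⬝ᵥ Δ₀) = -(e ⬝ᵥ (Xᵀ *ᵥ r)) := by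
    have := congrArg (fun v => e ⬝ᵥ v) h
    simpa [add_mulVec, smul_mulVec, ← mulVec_mulVec, dotProduct_add] using this
  have key : ∀ w : Fin k → ℝ, e ⬝ᵥ (Xᵀ *ᵥ w) = (X *ᵥ e) ⬝ᵥ w := fun w => by
    rw [dotProduct_mulVec, vecMul_transpose]
  rw [key, key] at h2
  have c1 : (X *ᵥ Δ₀) ⬝ᵥ (X *ᵥ e) = (X *ᵥ e) ⬝ᵥ (X *ᵥ Δ₀) := dotProduct_comm _ _
  have c2 : r ⬝ᵥ (X *ᵥ e) = (X *ᵥ e) ⬝ᵥ r := dotProduct_comm _ _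
  have c3 : Δ₀ ⬝ᵥ e = e ⬝ᵥ Δ₀ := dotProduct_comm _ _
  have c4 : r ⬝ᵥ (X *ᵥ Δ₀) = (X *ᵥ Δ₀) ⬝ᵥ r := dotProduct_comm _ _
  simp only [ridgeObjective, sqNorm_eq_dotProduct, add_sub_cancel_left, mulVec_add,
    dotProduct_add, add_dotProduct, c1, c2, c3, c4]
  linarith

/-- For `lam > 0` the ridge objective has exactly one minimizer, namely `ridgeArgmin lam X r`. -/
theorem isMinOn_ridgeObjective_iff {k p : ℕ} {lam : ℝ} (hlam : 0 < lam)
    (X : Matrix (Fin k) (Fin p) ℝ) (r : Fin k → ℝ) (Δ : Fin p → ℝ) :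
    IsMinOn (ridgeObjective lam X r) Set.univ Δ ↔ Δ = ridgeArgmin lam X r := by
  have hdet := (posDef_ridge hlam X).isUnit
  set G := Xᵀ * X + lam • (1 : Matrix (Fin p) (Fin p) ℝ) with hG
  set Δ₀ := G⁻¹ *ᵥ (-(Xᵀ *ᵥ r)) with hΔ₀
  have h0 : G *ᵥ Δ₀ = -(Xᵀ *ᵥ r) := by
    rw [hΔ₀, mulVec_mulVec, Matrix.mul_nonsing_inv _ ((isUnit_iff_isUnit_det _).1 hdet),
      one_mulVec]
  have hexp := fun D => ridgeObjective_expand lam X r Δ₀ D h0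
  have hmin : IsMinOn (ridgeObjective lam X r) Set.univ Δ₀ := by
    intro D _
    have h1 := sqNorm_nonneg (X *ᵥ (D - Δ₀))
    have h2 := mul_nonneg hlam.le (sqNorm_nonneg (D - Δ₀))
    change ridgeObjective lam X r Δ₀ ≤ ridgeObjective lam X r D
    rw [hexp D]
    linarith
  have huniq : ∀ D, IsMinOn (ridgeObjective lam X r) Set.univ D → D = Δ₀ := by
    intro D hD
    have h3 : ridgeObjective lam X r D ≤ ridgeObjective lam X r Δ₀ := hD (Set.mem_univ Δ₀)
    rw [hexp D] at h3
    have h1 := sqNorm_nonneg (X *ᵥ (D - Δ₀))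
    have h2 := sqNorm_nonneg (D - Δ₀)
    have h4 : sqNorm (D - Δ₀) = 0 := by nlinarith
    rw [sqNorm_eq_dotProduct, dotProduct_self_eq_zero] at h4
    exact sub_eq_zero.1 h4
  have hspec : IsMinOn (ridgeObjective lam X r) Set.univ (ridgeArgmin lam X r) :=
    Classical.epsilon_spec (p := fun D => IsMinOn (ridgeObjective lam X r) Set.univ D) ⟨Δ₀, hmin⟩
  constructor
  · intro h
    rw [huniq _ h, huniq _ hspec]
  · rintro rfl
    exact hspec

section Pooled

variable {n m p : ℕ}

/-- The ridge-regularized estimate of the confounding bias: fit `α̂_O` on the observational data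
`(XO, YO)`, form the interventional residuals `r = YI - XI α̂_O`, and minimize
`‖r + XI Δ‖₂² + lam ‖Δ‖₂²`. -/
noncomputable def biasRidge (lam : ℝ) (XO : Matrix (Fin n) (Fin p) ℝ) (YO : Fin n → ℝ)
    (XI : Matrix (Fin m) (Fin p) ℝ) (YI : Fin m → ℝ) : Fin p → ℝ :=
  ridgeArgmin lam XI (YI - XI *ᵥ ols XO YO)

/-- The plug-in estimate of the optimal weight matrix for a given estimate `Δ` of the confounding
bias:
`(Ĉov(α̂_O) + Δ Δᵀ + ε I) (Ĉov(α̂_I) + Ĉov(α̂_O) + Δ Δᵀ + ε I)⁻¹`. -/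
noncomputable def weightOf (ε : ℝ) (Δ : Fin p → ℝ)
    (XO : Matrix (Fin n) (Fin p) ℝ) (YO : Fin n → ℝ)
    (XI : Matrix (Fin m) (Fin p) ℝ) (YI : Fin m → ℝ) : Matrix (Fin p) (Fin p) ℝ :=
  (covHat XO YO + vecMulVec Δ Δ + ε • (1 : Matrix (Fin p) (Fin p) ℝ)) *
    (covHat XI YI + covHat XO YO + vecMulVec Δ Δ + ε • (1 : Matrix (Fin p) (Fin p) ℝ))⁻¹

/-- The weight matrix built with the ridge-regularized estimate of the confounding bias. -/
noncomputable def weightRidge (ε lam : ℝ) (XO : Matrix (Fin n) (Fin p) ℝ) (YO : Fin n → ℝ)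
    (XI : Matrix (Fin m) (Fin p) ℝ) (YI : Fin m → ℝ) : Matrix (Fin p) (Fin p) ℝ :=
  weightOf ε (biasRidge lam XO YO XI YI) XO YO XI YI

/-- The `W`-weighted linear estimator `W α̂_I + (I - W) α̂_O`. -/
noncomputable def weighted (W : Matrix (Fin p) (Fin p) ℝ)
    (XO : Matrix (Fin n) (Fin p) ℝ) (YO : Fin n → ℝ)
    (XI : Matrix (Fin m) (Fin p) ℝ) (YI : Fin m → ℝ) : Fin p → ℝ :=
  W *ᵥ ols XI YI + (1 - W) *ᵥ ols XO YO

end Pooled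

/-! ### The structural equation model -/

/-- The parameters of the linear Gaussian structural equation model
`Z ← N_Z`, `X ← B Z + N_X`, `Y ← Zᵀγ + Xᵀα + N_Y` with independent centred Gaussian noises
`N_Z ~ N(0, covZ)`, `N_X ~ N(0, covX)`, `N_Y ~ N(0, varY)`. -/
structure LinearGaussianSEM (p d : ℕ) where
  B : Matrix (Fin p) (Fin d) ℝ
  γ : Fin d → ℝ
  α : Fin p → ℝ
  covZ : Matrix (Fin d) (Fin d) ℝ
  covX : Matrix (Fin p) (Fin p) ℝ
  varY : ℝ≥0
  covZ_posSemidef : covZ.PosSemidef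
  covX_posSemidef : covX.PosSemidef

/-- The centred Gaussian distribution `N(0, S)` on `ℝ^k`. -/
noncomputable def centeredGaussian {k : ℕ} (S : Matrix (Fin k) (Fin k) ℝ) :
    Measure (Fin k → ℝ) :=
  (multivariateGaussian 0 S).map (WithLp.ofLp : EuclideanSpace ℝ (Fin k) → Fin k → ℝ)

namespace LinearGaussianSEM

variable {p d : ℕ} (M : LinearGaussianSEM p d)

/-- The structural assignment of the outcome. -/
def outcome (z : Fin d → ℝ) (x : Fin p → ℝ) (ny : ℝ) : ℝ := z ⬝ᵥ M.γ + x ⬝ᵥ M.α + ny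

/-- The observational distribution of `(X, Y)`. -/
noncomputable def obsLaw : Measure ((Fin p → ℝ) × ℝ) :=
  ((centeredGaussian M.covZ).prod
      ((centeredGaussian M.covX).prod (gaussianReal 0 M.varY))).map
    fun w => (M.B *ᵥ w.1 + w.2.1, M.outcome w.1 (M.B *ᵥ w.1 + w.2.1) w.2.2)

/-- The interventional distribution of `(X, Y)`, when the assignment of `X` is replaced by
`X ← Ñ_X` with `Ñ_X ~ ν` independent of `N_Z` and `N_Y`. -/
noncomputable def intLaw (ν : Measure (Fin p → ℝ)) : Measure ((Fin p → ℝ) × ℝ) :=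
  ((centeredGaussian M.covZ).prod (ν.prod (gaussianReal 0 M.varY))).map
    fun w => (w.2.1, M.outcome w.1 w.2.1 w.2.2)

/-- The law of the pooled data: `n` i.i.d. observational and, independently of them, `m` i.i.d.
interventional observations of `(X, Y)`. -/
noncomputable def dataLaw (ν : Measure (Fin p → ℝ)) (n m : ℕ) :
    Measure ((Fin n → (Fin p → ℝ) × ℝ) × (Fin m → (Fin p → ℝ) × ℝ)) :=
  (Measure.pi fun _ => M.obsLaw).prod (Measure.pi fun _ => M.intLaw ν)

/-- The design matrix of a sample. -/
def design {k p : ℕ} (s : Fin k → (Fin p → ℝ) × ℝ) : Matrix (Fin k) (Fin p) ℝ :=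
  Matrix.of fun i => (s i).1

/-- The outcome vector of a sample. -/
def outcomes {k p : ℕ} (s : Fin k → (Fin p → ℝ) × ℝ) : Fin k → ℝ := fun i => (s i).2

/-- The mean squared error `E ‖α̂ - α‖₂²`, with values in `[0, ∞]`, of an estimator `α̂` that is a
function of the pooled data `(XO, YO, XI, YI)`. -/
noncomputable def mse (ν : Measure (Fin p → ℝ)) {n m : ℕ}
    (est : Matrix (Fin n) (Fin p) ℝ → (Fin n → ℝ) → Matrix (Fin m) (Fin p) ℝ → (Fin m → ℝ) →
      Fin p → ℝ) : ℝ≥0∞ :=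
  ∫⁻ s, ENNReal.ofReal
      (sqNorm (est (design s.1) (outcomes s.1) (design s.2) (outcomes s.2) - M.α))
    ∂(M.dataLaw ν n m)

end LinearGaussianSEM

end CausalShrinkage

/-! The risk is O(1/m) as soon as n exceeds a fixed threshold. Write S = XIᵀXI, w for the least
squares fit of the interventional noise, s for the residual variance, β = α - α̂_O, A for the
numerator of the weight and M = s S⁻¹ + A. On an invertible design the error is A M⁻¹(w + β) - β,
which also equals w - s S⁻¹M⁻¹(w + β).

The second form settles the designs with S ≥ κm: w and S⁻¹ are small and M ≥ ε, so the squared error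
is O(1/m) (`sqNorm_error_le_of_coercive_gram`). The treatment law may lack moments and a density, so
S⁻¹ need not have moments on the other designs. These have probability O(1/m), by Chebyshev's
inequality for the bounded matrix xxᵀ/(1 + ‖x‖²) (`exists_coercive_gram`). It therefore suffices to
bound the conditional risk uniformly over all designs.

That bound is `exists_sqNorm_error_le`, from the first form. Since M ≥ s S⁻¹ + ε, Young's inequality
gives ‖M⁻¹w‖² ≤ G/(4sε) with G = ‖XI w‖², however ill-conditioned S is; comparing the ridge
minimizer with -β bounds Δ by G and β. Given an invertible design, G and s are multiples of χ²
variables with p and m - p degrees of freedom, so their moments, negative ones of s included, are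
controlled uniformly. Singular designs (estimator 0) and vanishing noise (exact estimator) are
treated apart.

The observational sample enters only through a θ that dominates ‖β‖² and the operator norm of Ĉ_O,
and a bound on E θ³ uniform in n is needed (`exists_observational_envelope`). This asks for negative
moments of the least eigenvalue of XOᵀXO/n. `inv_pow_le_mul_lintegral_shell` trades the random worst
direction for an integral over fixed directions; for each of these, AM-GM and independence
(`lintegral_inv_mean_sq_pow_le`) leave only E|N|^(-1/2) for a Gaussian N.

Measurability of the estimator is never needed: `lintegral_map_le` and `lintegral_prod_le` bound
integrals of arbitrary functions from above, and the majorants are measurable where it matters. -/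

namespace CausalShrinkage

/-! ### Squared norms and Gram matrices -/

section SqNorm

variable {ι κ : Type*} [Fintype ι] [Fintype κ]

theorem sq_dotProduct_le (u v : ι → ℝ) : (u ⬝ᵥ v) ^ 2 ≤ sqNorm u * sqNorm v :=
  Finset.sum_mul_sq_le_sq_mul_sq _ _ _

theorem sqNorm_smul (c : ℝ) (v : ι → ℝ) : sqNorm (c • v) = c ^ 2 * sqNorm v := by
  simp [sqNorm, mul_pow, Finset.mul_sum]

@[simp] theorem sqNorm_neg (v : ι → ℝ) : sqNorm (-v) = sqNorm v := by simp [sqNorm]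

@[simp] theorem sqNorm_zero : sqNorm (0 : ι → ℝ) = 0 := by simp [sqNorm]

theorem sqNorm_eq_zero {v : ι → ℝ} : sqNorm v = 0 ↔ v = 0 := by
  rw [sqNorm_eq_dotProduct, dotProduct_self_eq_zero]

theorem sqNorm_add_le (u v : ι → ℝ) : sqNorm (u + v) ≤ 2 * (sqNorm u + sqNorm v) := by
  simp only [sqNorm, ← Finset.sum_add_distrib, Finset.mul_sum]
  refine Finset.sum_le_sum fun i _ => ?_
  simp only [Pi.add_apply]
  nlinarith [sq_nonneg (u i - v i)]

theorem sqNorm_add_add_le (u v w : ι → ℝ) :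
    sqNorm (u + v + w) ≤ 3 * (sqNorm u + sqNorm v + sqNorm w) := by
  simp only [sqNorm, ← Finset.sum_add_distrib, Finset.mul_sum]
  refine Finset.sum_le_sum fun i _ => ?_
  simp only [Pi.add_apply]
  nlinarith [sq_nonneg (u i - v i), sq_nonneg (u i - w i), sq_nonneg (v i - w i)]

theorem sqNorm_add_of_dotProduct_eq_zero {u v : ι → ℝ} (h : u ⬝ᵥ v = 0) :
    sqNorm (u + v) = sqNorm u + sqNorm v := by
  have h' : v ⬝ᵥ u = 0 := by rw [dotProduct_comm, h]
  simp [sqNorm_eq_dotProduct, h, h']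

/-- A coercive matrix is bounded below. -/
theorem sq_mul_sqNorm_le_of_coercive {c : ℝ} (hc : 0 ≤ c) {q b : ι → ℝ}
    (h : c * sqNorm q ≤ q ⬝ᵥ b) : c ^ 2 * sqNorm q ≤ sqNorm b := by
  have h1 := sq_dotProduct_le q b
  have h2 := sqNorm_nonneg q
  have h3 : (c * sqNorm q) ^ 2 ≤ (q ⬝ᵥ b) ^ 2 := pow_le_pow_left₀ (by positivity) h 2
  rcases h2.eq_or_lt with h0 | h0
  · rw [← h0]; simpa using sqNorm_nonneg b
  · have : sqNorm q * (c ^ 2 * sqNorm q) ≤ sqNorm q * sqNorm b := by nlinarith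
    exact le_of_mul_le_mul_left this h0

theorem transpose_mulVec_dotProduct (X : Matrix κ ι ℝ) (u : κ → ℝ) (v : ι → ℝ) :
    (Xᵀ *ᵥ u) ⬝ᵥ v = u ⬝ᵥ (X *ᵥ v) := by
  rw [mulVec_transpose, dotProduct_mulVec]

theorem gram_mulVec_dotProduct (X : Matrix κ ι ℝ) (u v : ι → ℝ) :
    ((Xᵀ * X) *ᵥ u) ⬝ᵥ v = (X *ᵥ u) ⬝ᵥ (X *ᵥ v) := by
  rw [← mulVec_mulVec, transpose_mulVec_dotProduct]

theorem posSemidef_gram (X : Matrix κ ι ℝ) : (Xᵀ * X).PosSemidef := by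
  simpa [conjTranspose_eq_transpose_of_trivial] using posSemidef_conjTranspose_mul_self X

theorem posSemidef_dotProduct_mulVec_nonneg {C : Matrix ι ι ℝ} (hC : C.PosSemidef) (q : ι → ℝ) :
    0 ≤ q ⬝ᵥ (C *ᵥ q) := by
  simpa using hC.dotProduct_mulVec_nonneg q

end SqNorm

/-! ### Algebra of least squares and ridge regression -/

section LeastSquares

variable {k p : ℕ} (X : Matrix (Fin k) (Fin p) ℝ)

theorem varHat_nonneg (Y : Fin k → ℝ) : 0 ≤ varHat X Y := by
  rcases Nat.eq_zero_or_pos k with rfl | hk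
  · simp [varHat, sqNorm]
  · have : (0 : ℝ) ≤ (k : ℝ) - 1 := by
      have : (1 : ℝ) ≤ k := by exact_mod_cast hk
      linarith
    exact mul_nonneg (by positivity) (sqNorm_nonneg _)

theorem posSemidef_covHat (Y : Fin k → ℝ) : (covHat X Y).PosSemidef :=
  (posSemidef_gram X).inv.smul (varHat_nonneg X Y)

variable {X}

theorem ols_add (hX : IsUnit (Xᵀ * X).det) (a : Fin p → ℝ) (e : Fin k → ℝ) :
    ols X (X *ᵥ a + e) = a + ols X e := by
  rw [ols, mulVec_add, mulVec_add, mulVec_mulVec, mulVec_mulVec, Matrix.mul_assoc,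
    Matrix.nonsing_inv_mul _ hX, one_mulVec, ols]

theorem varHat_add (hX : IsUnit (Xᵀ * X).det) (a : Fin p → ℝ) (e : Fin k → ℝ) :
    varHat X (X *ᵥ a + e) = varHat X e := by
  rw [varHat, varHat, ols_add hX, mulVec_add, add_sub_add_left_eq_sub]

/-- The residuals of a least squares fit are orthogonal to the columns of the design. -/
theorem residual_dotProduct (hX : IsUnit (Xᵀ * X).det) (e : Fin k → ℝ) (v : Fin p → ℝ) :
    (e - X *ᵥ ols X e) ⬝ᵥ (X *ᵥ v) = 0 := by
  rw [← transpose_mulVec_dotProduct, mulVec_sub, ols, mulVec_mulVec, mulVec_mulVec,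
    Matrix.mul_nonsing_inv _ hX, one_mulVec, sub_self, zero_dotProduct]

theorem sqNorm_fit_add_sqNorm_residual (hX : IsUnit (Xᵀ * X).det) (e : Fin k → ℝ) :
    sqNorm (e - X *ᵥ ols X e) + sqNorm (X *ᵥ ols X e) = sqNorm e := by
  rw [← sqNorm_add_of_dotProduct_eq_zero (residual_dotProduct hX e _), sub_add_cancel]

theorem isUnit_gram_of_forall_pos (h : ∀ v, v ≠ 0 → 0 < sqNorm (X *ᵥ v)) :
    IsUnit (Xᵀ * X).det := by
  have : (Xᵀ * X).PosDef := by
    refine PosDef.of_dotProduct_mulVec_pos (posSemidef_gram X).1 fun {v} hv => ?_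
    rw [star_trivial, dotProduct_comm, gram_mulVec_dotProduct, ← sqNorm_eq_dotProduct]
    exact h v hv
  exact (isUnit_iff_isUnit_det _).1 this.isUnit

/-- The ridge estimate of the bias is bounded by the projected noise and the true bias,
whatever the design. -/
theorem mul_sqNorm_ridgeArgmin_le {lam : ℝ} (hlam : 0 < lam) (hX : IsUnit (Xᵀ * X).det)
    (e : Fin k → ℝ) (β : Fin p → ℝ) :
    lam * sqNorm (ridgeArgmin lam X (e + X *ᵥ β)) ≤ sqNorm (X *ᵥ ols X e) + lam * sqNorm β := by
  have hmin := (isMinOn_ridgeObjective_iff hlam X (e + X *ᵥ β) _).2 rfl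
  set Δ := ridgeArgmin lam X (e + X *ᵥ β)
  -- The competitor -β cancels the bias exactly and leaves the objective ‖e‖² + lam ‖β‖². The
  -- residual of e appears on both sides and cancels, so only the projected noise survives.
  have h : ridgeObjective lam X (e + X *ᵥ β) Δ ≤ ridgeObjective lam X (e + X *ᵥ β) (-β) :=
    hmin (Set.mem_univ _)
  have h1 : e + X *ᵥ β + X *ᵥ Δ = (e - X *ᵥ ols X e) + X *ᵥ (ols X e + β + Δ) := by
    simp only [mulVec_add]; abel
  have h2 : e + X *ᵥ β + X *ᵥ (-β) = e := by simp [mulVec_neg]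
  rw [ridgeObjective, ridgeObjective, h1, h2, sqNorm_neg,
    sqNorm_add_of_dotProduct_eq_zero (residual_dotProduct hX e _)] at h
  have h3 := sqNorm_fit_add_sqNorm_residual hX e
  have h4 := sqNorm_nonneg (X *ᵥ (ols X e + β + Δ))
  linarith

end LeastSquares

/-! ### Deterministic error bounds for the weighted estimator -/

section Weighted

variable {n m p : ℕ} {ε lam : ℝ} {XO : Matrix (Fin n) (Fin p) ℝ} {YO : Fin n → ℝ}
  {XI : Matrix (Fin m) (Fin p) ℝ}

/-- The observational covariance and the rank-one term are nonnegative and are dropped. The two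
terms kept play different roles: ε bounds the inverse, and the multiple of S⁻¹ compensates for an
ill-conditioned design. -/
theorem weightDenominator_coercive (Δ : Fin p → ℝ) (YI : Fin m → ℝ) (q : Fin p → ℝ) :
    varHat XI YI * (q ⬝ᵥ ((XIᵀ * XI)⁻¹ *ᵥ q)) + ε * sqNorm q ≤
      q ⬝ᵥ ((covHat XI YI + covHat XO YO + vecMulVec Δ Δ +
        ε • (1 : Matrix (Fin p) (Fin p) ℝ)) *ᵥ q) := by
  have h1 := posSemidef_dotProduct_mulVec_nonneg (posSemidef_covHat XO YO) q
  have h2 : q ⬝ᵥ (vecMulVec Δ Δ *ᵥ q) = (Δ ⬝ᵥ q) ^ 2 := by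
    rw [vecMulVec_mulVec]
    simp [dotProduct_comm q Δ, sq]
  simp only [add_mulVec, dotProduct_add, h2, smul_mulVec, one_mulVec, dotProduct_smul,
    smul_eq_mul, sqNorm_eq_dotProduct]
  rw [covHat, smul_mulVec, dotProduct_smul, smul_eq_mul]
  nlinarith [sq_nonneg (Δ ⬝ᵥ q)]

theorem posDef_weightDenominator (hε : 0 < ε) (Δ : Fin p → ℝ) (YI : Fin m → ℝ) :
    (covHat XI YI + covHat XO YO + vecMulVec Δ Δ +
      ε • (1 : Matrix (Fin p) (Fin p) ℝ)).PosDef := by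
  have h3 : (vecMulVec Δ Δ).PosSemidef := by simpa using posSemidef_vecMulVec_self_star Δ
  exact PosDef.posSemidef_add
    (((posSemidef_covHat XI YI).add (posSemidef_covHat XO YO)).add h3) (PosDef.one.smul hε)

/-- On a degenerate interventional sample the weighted estimator is `0`. -/
theorem weighted_of_not_isUnit (hε : 0 < ε) (hX : ¬ IsUnit (XIᵀ * XI).det) (YI : Fin m → ℝ) :
    weighted (weightRidge ε lam XO YO XI YI) XO YO XI YI = 0 := by
  have hinv : (XIᵀ * XI)⁻¹ = 0 := Matrix.nonsing_inv_apply_not_isUnit _ hX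
  have hC : covHat XI YI = 0 := by rw [covHat, hinv, smul_zero]
  have hW : weightRidge ε lam XO YO XI YI = 1 := by
    have := posDef_weightDenominator (XO := XO) (YO := YO) (XI := XI) hε
      (biasRidge lam XO YO XI YI) YI
    rw [hC, zero_add] at this
    rw [weightRidge, weightOf, hC, zero_add,
      Matrix.mul_nonsing_inv _ ((isUnit_iff_isUnit_det _).1 this.isUnit)]
  rw [weighted, hW, ols, hinv]
  simp

variable {α : Fin p → ℝ}

/-- Without noise the weighted estimator is exact. -/
theorem weighted_of_noiseless (hε : 0 < ε) (hX : IsUnit (XIᵀ * XI).det) :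
    weighted (weightRidge ε lam XO YO XI (XI *ᵥ α)) XO YO XI (XI *ᵥ α) = α := by
  have h0 : ols XI (XI *ᵥ α) = α := by
    have := ols_add hX α 0
    rw [add_zero] at this
    rw [this, ols]; simp
  have hC : covHat XI (XI *ᵥ α) = 0 := by
    rw [covHat, varHat, h0]; simp
  have hW : weightRidge ε lam XO YO XI (XI *ᵥ α) = 1 := by
    have := posDef_weightDenominator (XO := XO) (YO := YO) (XI := XI) hε
      (biasRidge lam XO YO XI (XI *ᵥ α)) (XI *ᵥ α)
    rw [hC, zero_add] at this
    rw [weightRidge, weightOf, hC, zero_add,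
      Matrix.mul_nonsing_inv _ ((isUnit_iff_isUnit_det _).1 this.isUnit)]
  rw [weighted, hW, h0]
  simp

theorem sqNorm_weightNumerator_le {C : Matrix (Fin p) (Fin p) ℝ} {θ : ℝ}
    (hC : ∀ v, sqNorm (C *ᵥ v) ≤ θ ^ 2 * sqNorm v) (ε : ℝ) (Δ q : Fin p → ℝ) :
    sqNorm ((C + vecMulVec Δ Δ + ε • (1 : Matrix (Fin p) (Fin p) ℝ)) *ᵥ q) ≤
      3 * (θ ^ 2 + sqNorm Δ ^ 2 + ε ^ 2) * sqNorm q := by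
  rw [add_mulVec, add_mulVec, smul_mulVec, one_mulVec, vecMulVec_mulVec]
  refine (sqNorm_add_add_le _ _ _).trans ?_
  have h1 := hC q
  have h2 : sqNorm (MulOpposite.op (Δ ⬝ᵥ q) • Δ) ≤ sqNorm Δ ^ 2 * sqNorm q := by
    rw [op_smul_eq_smul, sqNorm_smul]
    have := mul_le_mul_of_nonneg_right (sq_dotProduct_le Δ q) (sqNorm_nonneg Δ)
    nlinarith
  rw [sqNorm_smul]
  nlinarith

/-- Scalar bookkeeping: d is at most a constant times θ(1 + G), so the numerator factor is at most a
constant times θ²(1 + G)²; the third θ comes from x₂. The product (1 + G)³s⁻¹ is split into a sum of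
squares, so that moments of G and of s⁻¹ can be taken separately. -/
theorem error_envelope (hε : 0 < ε) (hlam : 0 < lam) {θ G s b d x₁ x₂ y₁ y₂ : ℝ}
    (hθ : 1 ≤ θ) (hG0 : 0 ≤ G) (hs : 0 < s) (hd0 : 0 ≤ d) (hd : d ≤ G / lam + θ) (hb : b ≤ θ)
    (hy₁ : y₁ ≤ 3 * (θ ^ 2 + d ^ 2 + ε ^ 2) * x₁) (hy₂ : y₂ ≤ 3 * (θ ^ 2 + d ^ 2 + ε ^ 2) * x₂)
    (hx₁ : 4 * s * ε * x₁ ≤ G) (hx₂ : ε ^ 2 * x₂ ≤ θ) (hx₁0 : 0 ≤ x₁) (hx₂0 : 0 ≤ x₂) :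
    3 * (b + y₁ + y₂) ≤
      3 * (1 + (3 * (1 + (1 / lam + 1) ^ 2 + ε ^ 2)) / (4 * ε) +
        (3 * (1 + (1 / lam + 1) ^ 2 + ε ^ 2)) / ε ^ 2) * θ ^ 3 * ((1 + G) ^ 6 + s⁻¹ ^ 2) := by
  set K₁ : ℝ := 3 * (1 + (1 / lam + 1) ^ 2 + ε ^ 2) with hK₁
  have hK₁pos : 0 < K₁ := by positivity
  have hθ0 : 0 < θ := by linarith
  have hd' : d ≤ (1 / lam + 1) * (θ * (1 + G)) := by
    have h1 : (1 / lam + 1) * (θ * (1 + G)) = G / lam + θ + (1 / lam * (θ + (θ - 1) * G) + θ * G) := by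
      ring
    have h2 : 0 ≤ 1 / lam * (θ + (θ - 1) * G) + θ * G := by
      have : 0 ≤ (θ - 1) * G := mul_nonneg (by linarith) hG0
      positivity
    rw [h1]
    linarith
  have ha : 3 * (θ ^ 2 + d ^ 2 + ε ^ 2) ≤ K₁ * (θ ^ 2 * (1 + G) ^ 2) := by
    have h1 : d ^ 2 ≤ (1 / lam + 1) ^ 2 * (θ ^ 2 * (1 + G) ^ 2) := by
      rw [← mul_pow, ← mul_pow]; exact pow_le_pow_left₀ hd0 hd' 2
    have h2 : 1 ≤ (1 + G) ^ 2 := one_le_pow₀ (by linarith)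
    have h3 : 1 ≤ θ ^ 2 := one_le_pow₀ hθ
    have h4 : θ ^ 2 ≤ θ ^ 2 * (1 + G) ^ 2 := le_mul_of_one_le_right (by positivity) h2
    have h5 : ε ^ 2 ≤ ε ^ 2 * (θ ^ 2 * (1 + G) ^ 2) :=
      le_mul_of_one_le_right (by positivity) (by linarith)
    rw [hK₁]; linarith
  have hg1 : 1 ≤ 1 + G := by linarith
  have hg0 : G ≤ 1 + G := by linarith
  clear_value K₁
  generalize 1 + G = g at *
  have hsi : 0 < s⁻¹ := inv_pos.2 hs
  have hx₁' : x₁ ≤ g * s⁻¹ / (4 * ε) := by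
    rw [le_div_iff₀ (by positivity), ← div_eq_mul_inv, le_div_iff₀ hs]
    linarith
  have hx₂' : x₂ ≤ θ / ε ^ 2 := by
    rw [le_div_iff₀ (by positivity)]; linarith
  have hA₁ : y₁ ≤ K₁ * (θ ^ 2 * g ^ 2) * (g * s⁻¹ / (4 * ε)) :=
    hy₁.trans (mul_le_mul ha hx₁' hx₁0 (by positivity))
  have hA₂ : y₂ ≤ K₁ * (θ ^ 2 * g ^ 2) * (θ / ε ^ 2) :=
    hy₂.trans (mul_le_mul ha hx₂' hx₂0 (by positivity))
  set R := g ^ 6 + s⁻¹ ^ 2 with hR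
  have hgR : g ^ 3 * s⁻¹ ≤ R := by
    have := two_mul_le_add_sq (g ^ 3) s⁻¹
    have h0 : 0 ≤ g ^ 3 * s⁻¹ := by positivity
    have h6 : (g ^ 3) ^ 2 = g ^ 6 := by ring
    rw [hR]; linarith
  have hg6 : g ^ 2 ≤ R := by
    have h1 : g ^ 2 ≤ g ^ 6 := pow_le_pow_right₀ hg1 (by norm_num)
    have h2 : 0 ≤ s⁻¹ ^ 2 := by positivity
    rw [hR]; linarith
  have h1R : 1 ≤ R := (one_le_pow₀ hg1).trans hg6
  have hθ23 : θ ^ 2 ≤ θ ^ 3 := pow_le_pow_right₀ hθ (by norm_num)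
  have hθ13 : θ ≤ θ ^ 3 := le_self_pow₀ hθ (by norm_num)
  have e0 : b ≤ θ ^ 3 * R :=
    (hb.trans hθ13).trans (le_mul_of_one_le_right (by positivity) h1R)
  have e1 : y₁ ≤ K₁ / (4 * ε) * (θ ^ 3 * R) := by
    refine hA₁.trans ?_
    rw [show K₁ * (θ ^ 2 * g ^ 2) * (g * s⁻¹ / (4 * ε)) = K₁ / (4 * ε) * (θ ^ 2 * (g ^ 3 * s⁻¹)) by
      ring]
    gcongr
  have e2 : y₂ ≤ K₁ / ε ^ 2 * (θ ^ 3 * R) := by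
    refine hA₂.trans ?_
    rw [show K₁ * (θ ^ 2 * g ^ 2) * (θ / ε ^ 2) = K₁ / ε ^ 2 * (θ ^ 3 * g ^ 2) by ring]
    gcongr
  linarith

/-- Error bound that holds for every non-degenerate interventional design. -/
theorem exists_sqNorm_error_le (p : ℕ) (hε : 0 < ε) (hlam : 0 < lam) :
    ∃ K : ℝ, 0 < K ∧ ∀ {n m : ℕ} (XO : Matrix (Fin n) (Fin p) ℝ) (YO : Fin n → ℝ)
      (XI : Matrix (Fin m) (Fin p) ℝ) (e : Fin m → ℝ) (α : Fin p → ℝ) (θ : ℝ),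
      IsUnit (XIᵀ * XI).det → 1 ≤ θ → sqNorm (α - ols XO YO) ≤ θ →
      (∀ v, sqNorm (covHat XO YO *ᵥ v) ≤ θ ^ 2 * sqNorm v) → 0 < varHat XI e →
      sqNorm (weighted (weightRidge ε lam XO YO XI (XI *ᵥ α + e)) XO YO XI (XI *ᵥ α + e) - α) ≤
        K * θ ^ 3 * ((1 + sqNorm (XI *ᵥ ols XI e)) ^ 6 + (varHat XI e)⁻¹ ^ 2) := by
  refine ⟨3 * (1 + (3 * (1 + (1 / lam + 1) ^ 2 + ε ^ 2)) / (4 * ε) +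
    (3 * (1 + (1 / lam + 1) ^ 2 + ε ^ 2)) / ε ^ 2), by positivity, ?_⟩
  intro n m XO YO XI e α θ hX hθ hβ hC hs
  set w := ols XI e with hw
  set s := varHat XI e with hsdef
  set β := α - ols XO YO with hβdef
  set G := sqNorm (XI *ᵥ w) with hG
  have hG0 : 0 ≤ G := sqNorm_nonneg _
  set Δ := biasRidge lam XO YO XI (XI *ᵥ α + e) with hΔdef
  have hΔ : sqNorm Δ ≤ G / lam + θ := by
    have h1 : XI *ᵥ α + e - XI *ᵥ ols XO YO = e + XI *ᵥ β := by
      rw [hβdef, mulVec_sub]; abel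
    have h2 := mul_sqNorm_ridgeArgmin_le hlam hX e β
    rw [← h1] at h2
    change lam * sqNorm Δ ≤ G + lam * sqNorm β at h2
    rw [div_add' _ _ _ hlam.ne', le_div_iff₀ hlam]
    nlinarith
  have hMpd := posDef_weightDenominator (XO := XO) (YO := YO) (XI := XI) hε Δ (XI *ᵥ α + e)
  have hcoer := weightDenominator_coercive (ε := ε) (XO := XO) (YO := YO) (XI := XI) Δ (XI *ᵥ α + e)
  set A := covHat XO YO + vecMulVec Δ Δ + ε • (1 : Matrix (Fin p) (Fin p) ℝ) with hA
  set Mm := covHat XI (XI *ᵥ α + e) + covHat XO YO + vecMulVec Δ Δ +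
    ε • (1 : Matrix (Fin p) (Fin p) ℝ) with hMm
  have hMu : IsUnit Mm.det := (isUnit_iff_isUnit_det _).1 hMpd.isUnit
  set q₁ := Mm⁻¹ *ᵥ w with hq₁
  set q₂ := Mm⁻¹ *ᵥ β with hq₂
  have hMq₁ : Mm *ᵥ q₁ = w := by rw [hq₁, mulVec_mulVec, Matrix.mul_nonsing_inv _ hMu, one_mulVec]
  have hMq₂ : Mm *ᵥ q₂ = β := by rw [hq₂, mulVec_mulVec, Matrix.mul_nonsing_inv _ hMu, one_mulVec]
  -- Here α̂_I = α̂_O + β + w, hence W α̂_I + (1 - W) α̂_O - α = W(w + β) - β.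
  have herr : weighted (weightRidge ε lam XO YO XI (XI *ᵥ α + e)) XO YO XI (XI *ᵥ α + e) - α =
      -β + A *ᵥ q₁ + A *ᵥ q₂ := by
    have hWdef : weightRidge ε lam XO YO XI (XI *ᵥ α + e) = A * Mm⁻¹ := rfl
    have : ols XI (XI *ᵥ α + e) = w + β + ols XO YO := by rw [ols_add hX, hβdef]; abel
    rw [weighted, hWdef, this, hq₁, hq₂, sub_mulVec, one_mulVec, mulVec_add, mulVec_add,
      mulVec_mulVec, mulVec_mulVec, hβdef]
    abel
  have hinvq : ∀ q, 0 ≤ q ⬝ᵥ ((XIᵀ * XI)⁻¹ *ᵥ q) := fun q =>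
    posSemidef_dotProduct_mulVec_nonneg (posSemidef_gram XI).inv q
  rw [varHat_add hX] at hcoer
  have hb₂ : ε ^ 2 * sqNorm q₂ ≤ θ := by
    refine (sq_mul_sqNorm_le_of_coercive hε.le (b := β) ?_).trans hβ
    have := hcoer q₂
    rw [hMq₂] at this
    nlinarith [mul_nonneg hs.le (hinvq q₂)]
  have hb₁ : 4 * s * ε * sqNorm q₁ ≤ G := by
    have h1 := hcoer q₁
    rw [hMq₁] at h1
    -- With q₁ = S t, both q₁ᵀS⁻¹q₁ = ‖XI t‖² and q₁ᵀw = ⟨XI t, XI w⟩ involve XI t only, so no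
    -- condition number of S appears.
    set t := (XIᵀ * XI)⁻¹ *ᵥ q₁ with ht
    have hSt : (XIᵀ * XI) *ᵥ t = q₁ := by
      rw [ht, mulVec_mulVec, Matrix.mul_nonsing_inv _ hX, one_mulVec]
    have h2 : q₁ ⬝ᵥ t = sqNorm (XI *ᵥ t) := by
      rw [← hSt, gram_mulVec_dotProduct, sqNorm_eq_dotProduct]
    have h3 : q₁ ⬝ᵥ w = (XI *ᵥ t) ⬝ᵥ (XI *ᵥ w) := by rw [← hSt, gram_mulVec_dotProduct]
    have h4 := sq_dotProduct_le (XI *ᵥ t) (XI *ᵥ w)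
    rw [h2, h3] at h1
    set T := sqNorm (XI *ᵥ t)
    set c := (XI *ᵥ t) ⬝ᵥ (XI *ᵥ w)
    have hT : 0 ≤ T := sqNorm_nonneg _
    change c ^ 2 ≤ T * G at h4
    -- Young's inequality with weights chosen so that the term 4s²T cancels against the S⁻¹ part of
    -- the coercivity bound multiplied by 4s.
    have h5 : 4 * s * c ≤ 4 * s ^ 2 * T + G := by
      by_contra hcon
      push Not at hcon
      have h6 : 0 ≤ 4 * s ^ 2 * T + G := by positivity
      have h7 : (4 * s ^ 2 * T + G) ^ 2 < (4 * s * c) ^ 2 := pow_lt_pow_left₀ hcon h6 two_ne_zero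
      have h8 : (4 * s * c) ^ 2 ≤ 16 * s ^ 2 * (T * G) := by
        have := mul_le_mul_of_nonneg_left h4 (by positivity : 0 ≤ 16 * s ^ 2)
        nlinarith
      nlinarith [sq_nonneg (4 * s ^ 2 * T - G)]
    nlinarith
  have hAq := sqNorm_weightNumerator_le hC ε Δ
  rw [← hA] at hAq
  rw [herr]
  refine (sqNorm_add_add_le _ _ _).trans ?_
  rw [sqNorm_neg]
  refine le_trans ?_ (error_envelope hε hlam hθ hG0 hs (sqNorm_nonneg Δ) hΔ hβ (hAq q₁) (hAq q₂) hb₁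
    hb₂ (sqNorm_nonneg q₁) (sqNorm_nonneg q₂))
  exact le_rfl

/-- Error bound for a well-conditioned interventional design. -/
theorem sqNorm_error_le_of_coercive_gram (hε : 0 < ε) {κ : ℝ} (hκ : 1 ≤ κ)
    (hcond : ∀ v, κ * sqNorm v ≤ sqNorm (XI *ᵥ v)) (e : Fin m → ℝ) {θ : ℝ} (hθ : 1 ≤ θ)
    (hβ : sqNorm (α - ols XO YO) ≤ θ) :
    sqNorm (weighted (weightRidge ε lam XO YO XI (XI *ᵥ α + e)) XO YO XI (XI *ᵥ α + e) - α) ≤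
      (2 + 4 / ε ^ 2) / κ * θ * ((1 + sqNorm (XI *ᵥ ols XI e)) ^ 2 + varHat XI e ^ 4) := by
  have hX : IsUnit (XIᵀ * XI).det := isUnit_gram_of_forall_pos fun v hv => by
    have : 0 < sqNorm v := lt_of_le_of_ne (sqNorm_nonneg v) fun h => hv (sqNorm_eq_zero.1 h.symm)
    nlinarith [hcond v]
  have hκ0 : 0 < κ := by linarith
  set w := ols XI e with hw
  set s := varHat XI e with hsdef
  have hs : 0 ≤ s := varHat_nonneg _ _
  set β := α - ols XO YO with hβdef
  set G := sqNorm (XI *ᵥ w) with hG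
  have hG0 : 0 ≤ G := sqNorm_nonneg _
  set Δ := biasRidge lam XO YO XI (XI *ᵥ α + e) with hΔdef
  have hMpd := posDef_weightDenominator (XO := XO) (YO := YO) (XI := XI) hε Δ (XI *ᵥ α + e)
  have hcoer := weightDenominator_coercive (ε := ε) (XO := XO) (YO := YO) (XI := XI) Δ (XI *ᵥ α + e)
  set A := covHat XO YO + vecMulVec Δ Δ + ε • (1 : Matrix (Fin p) (Fin p) ℝ) with hA
  set Mm := covHat XI (XI *ᵥ α + e) + covHat XO YO + vecMulVec Δ Δ +
    ε • (1 : Matrix (Fin p) (Fin p) ℝ) with hMm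
  have hMA : Mm = covHat XI (XI *ᵥ α + e) + A := by rw [hMm, hA]; abel
  have hMu : IsUnit Mm.det := (isUnit_iff_isUnit_det _).1 hMpd.isUnit
  set q := Mm⁻¹ *ᵥ (w + β) with hq
  have hMq : Mm *ᵥ q = w + β := by rw [hq, mulVec_mulVec, Matrix.mul_nonsing_inv _ hMu, one_mulVec]
  set t := (XIᵀ * XI)⁻¹ *ᵥ q with ht
  -- A = M - C_I turns A M⁻¹(w + β) - β into w - C_I M⁻¹(w + β). This form is small when S is large,
  -- and it needs no bound on Δ.
  have herr : weighted (weightRidge ε lam XO YO XI (XI *ᵥ α + e)) XO YO XI (XI *ᵥ α + e) - α =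
      w + (-s) • t := by
    have hWdef : weightRidge ε lam XO YO XI (XI *ᵥ α + e) = A * Mm⁻¹ := rfl
    have h1 : ols XI (XI *ᵥ α + e) = w + β + ols XO YO := by rw [ols_add hX, hβdef]; abel
    have h2 : A *ᵥ q = w + β - s • t := by
      have hCI : covHat XI (XI *ᵥ α + e) *ᵥ q = s • t := by
        rw [covHat, varHat_add hX, smul_mulVec]
      rw [eq_sub_iff_add_eq, ← hMq, hMA, add_mulVec (covHat XI (XI *ᵥ α + e)) A, hCI,
        add_comm]
    rw [weighted, hWdef, h1, sub_mulVec, one_mulVec, mulVec_add, ← mulVec_mulVec, ← hq, h2, hβdef,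
      neg_smul]
    abel
  have hSt : (XIᵀ * XI) *ᵥ t = q := by
    rw [ht, mulVec_mulVec, Matrix.mul_nonsing_inv _ hX, one_mulVec]
  have hqb : ε ^ 2 * sqNorm q ≤ sqNorm (w + β) := by
    refine sq_mul_sqNorm_le_of_coercive hε.le ?_
    have h1 := hcoer q
    rw [hMq] at h1
    have h2 := posSemidef_dotProduct_mulVec_nonneg (posSemidef_gram XI).inv q
    nlinarith [mul_nonneg (varHat_nonneg XI (XI *ᵥ α + e)) h2]
  have htb : κ ^ 2 * sqNorm t ≤ sqNorm q := by
    refine sq_mul_sqNorm_le_of_coercive hκ0.le ?_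
    rw [dotProduct_comm, ← hSt, gram_mulVec_dotProduct, ← sqNorm_eq_dotProduct]
    exact hcond t
  have hwb : κ * sqNorm w ≤ G := hcond w
  have hw0 := sqNorm_nonneg w
  have hwG : sqNorm w ≤ G := by nlinarith
  have hD := sqNorm_add_le w β
  have ht' : sqNorm t ≤ 2 * (G + θ) / ε ^ 2 / κ := by
    rw [le_div_iff₀ hκ0, le_div_iff₀ (by positivity)]
    have h1 : κ * sqNorm t ≤ κ ^ 2 * sqNorm t :=
      mul_le_mul_of_nonneg_right (le_self_pow₀ hκ two_ne_zero) (sqNorm_nonneg t)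
    have h2 := mul_le_mul_of_nonneg_left (h1.trans htb) (by positivity : 0 ≤ ε ^ 2)
    linarith
  have hw' : sqNorm w ≤ G / κ := by rw [le_div_iff₀ hκ0]; linarith
  rw [herr]
  refine (sqNorm_add_le _ _).trans ?_
  rw [sqNorm_smul, neg_sq]
  calc 2 * (sqNorm w + s ^ 2 * sqNorm t)
      ≤ 2 * (G / κ + s ^ 2 * (2 * (G + θ) / ε ^ 2 / κ)) := by gcongr
    _ = (2 * G + 4 / ε ^ 2 * (s ^ 2 * (G + θ))) / κ := by ring
    _ ≤ (2 * (θ * ((1 + G) ^ 2 + s ^ 4)) + 4 / ε ^ 2 * (θ * ((1 + G) ^ 2 + s ^ 4))) / κ := by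
        have h1 : G ≤ θ * ((1 + G) ^ 2 + s ^ 4) := by
          have : 0 ≤ s ^ 4 := by positivity
          nlinarith
        have h2 : s ^ 2 * (G + θ) ≤ θ * ((1 + G) ^ 2 + s ^ 4) := by
          have h3 : s ^ 2 * (G + θ) ≤ θ * (s ^ 2 * (1 + G)) := by
            have : 0 ≤ s ^ 2 * ((θ - 1) * G) := by
              have := mul_nonneg (sub_nonneg.2 hθ) hG0
              positivity
            nlinarith
          refine h3.trans (mul_le_mul_of_nonneg_left ?_ (by linarith))
          nlinarith [sq_nonneg (s ^ 2 - (1 + G)), sq_nonneg (s ^ 2), sq_nonneg (1 + G)]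
        gcongr
    _ = _ := by ring

end Weighted

/-! ### Bounds for the observational fit under a coercive Gram matrix -/

section ObservationalBounds

variable {k p : ℕ} {X : Matrix (Fin k) (Fin p) ℝ}

theorem mul_sqNorm_ols_le (hX : IsUnit (Xᵀ * X).det) {κ : ℝ}
    (hcond : ∀ v, κ * sqNorm v ≤ sqNorm (X *ᵥ v)) (Y : Fin k → ℝ) :
    κ * sqNorm (ols X Y) ≤ sqNorm Y := by
  have h1 := sqNorm_fit_add_sqNorm_residual hX Y
  have h2 := sqNorm_nonneg (Y - X *ᵥ ols X Y)
  linarith [hcond (ols X Y)]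

theorem sq_mul_sqNorm_covHat_mulVec_le (hX : IsUnit (Xᵀ * X).det) {κ : ℝ} (hκ : 0 ≤ κ)
    (hcond : ∀ v, κ * sqNorm v ≤ sqNorm (X *ᵥ v)) (Y : Fin k → ℝ) (v : Fin p → ℝ) :
    κ ^ 2 * sqNorm (covHat X Y *ᵥ v) ≤ varHat X Y ^ 2 * sqNorm v := by
  set t := (Xᵀ * X)⁻¹ *ᵥ v with ht
  have hSt : (Xᵀ * X) *ᵥ t = v := by
    rw [ht, mulVec_mulVec, Matrix.mul_nonsing_inv _ hX, one_mulVec]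
  have htb : κ ^ 2 * sqNorm t ≤ sqNorm v := by
    refine sq_mul_sqNorm_le_of_coercive hκ ?_
    rw [dotProduct_comm, ← hSt, gram_mulVec_dotProduct, ← sqNorm_eq_dotProduct]
    exact hcond t
  rw [covHat, smul_mulVec, sqNorm_smul, ← ht]
  nlinarith [sq_nonneg (varHat X Y)]

theorem varHat_le (hX : IsUnit (Xᵀ * X).det) (hk : 2 ≤ k) (Y : Fin k → ℝ) :
    varHat X Y ≤ 2 * (sqNorm Y / k) := by
  have h1 := sqNorm_fit_add_sqNorm_residual hX Y
  have h2 := sqNorm_nonneg (X *ᵥ ols X Y)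
  have hk' : (2 : ℝ) ≤ k := by exact_mod_cast hk
  rw [varHat, one_div_mul_eq_div, div_le_iff₀ (by linarith)]
  have h3 : 2 * (sqNorm Y / k) * (k - 1) = sqNorm Y * (2 * (k - 1) / k) := by ring
  rw [h3]
  -- The factor 2 absorbs k/(k - 1), which needs k ≥ 2.
  have h4 : 1 ≤ 2 * ((k : ℝ) - 1) / k := by rw [le_div_iff₀ (by linarith)]; linarith
  nlinarith [sqNorm_nonneg Y]

end ObservationalBounds

/-! ### Moments of means of squares of i.i.d. variables -/

/-- Jensen's inequality for the concave power r, read off from the monotonicity of Lʳ norms on a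
probability space. -/
theorem lintegral_rpow_le_rpow_lintegral {Ω : Type*} [MeasurableSpace Ω] (μ : Measure Ω)
    [IsProbabilityMeasure μ] {h : Ω → ℝ≥0∞} (hh : Measurable h) {r : ℝ} (hr : 0 < r)
    (hr1 : r ≤ 1) : ∫⁻ x, h x ^ r ∂μ ≤ (∫⁻ x, h x ∂μ) ^ r := by
  have h1 := eLpNorm'_le_eLpNorm'_of_exponent_le (μ := μ) hr hr1 hh.aestronglyMeasurable
  simp only [eLpNorm'_eq_lintegral_enorm, enorm_eq_self, ENNReal.rpow_one, div_one] at h1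
  calc ∫⁻ x, h x ^ r ∂μ = ((∫⁻ x, h x ^ r ∂μ) ^ (1 / r)) ^ r := by
        rw [← ENNReal.rpow_mul, one_div_mul_cancel hr.ne', ENNReal.rpow_one]
    _ ≤ _ := ENNReal.rpow_le_rpow h1 hr.le

theorem inv_finsetProd_of_ne_top {ι : Type*} (t : Finset ι) (f : ι → ℝ≥0∞) (hf : ∀ i ∈ t, f i ≠ ∞) :
    (∏ i ∈ t, f i)⁻¹ = ∏ i ∈ t, (f i)⁻¹ := by
  induction t using Finset.cons_induction with
  | empty => simp
  | cons j s hj ih =>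
    rw [Finset.prod_cons, Finset.prod_cons, ENNReal.mul_inv, ih fun i hi => hf i (by simp [hi])]
    · exact Or.inr (ENNReal.prod_ne_top fun i hi => hf i (by simp [hi]))
    · exact Or.inl (hf j (by simp))

/-- AM-GM for negative powers of a mean of squares. -/
theorem inv_mean_sq_pow_le_prod {ι : Type*} (t : Finset ι) (ht : t.Nonempty) (b : ι → ℝ) (q : ℕ) :
    (ENNReal.ofReal ((∑ i ∈ t, b i ^ 2) / (t.card : ℝ)))⁻¹ ^ q ≤
      ∏ i ∈ t, ((ENNReal.ofReal |b i|)⁻¹ ^ (2⁻¹ : ℝ)) ^ (4 * q / t.card : ℝ) := by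
  have hk : (0 : ℝ) < t.card := by exact_mod_cast ht.card_pos
  have h1 := Real.geom_mean_le_arith_mean_weighted t (fun _ => (t.card : ℝ)⁻¹) (fun i => b i ^ 2)
    (fun _ _ => by positivity) (by simp [hk.ne']) (fun _ _ => by positivity)
  rw [← Finset.mul_sum, inv_mul_eq_div] at h1
  have h2 := ENNReal.ofReal_le_ofReal h1
  rw [ENNReal.ofReal_prod_of_nonneg fun i _ => by positivity] at h2
  have h3 := pow_le_pow_left' (ENNReal.inv_le_inv.2 h2) q
  refine h3.trans (le_of_eq ?_)
  rw [inv_finsetProd_of_ne_top _ _ fun _ _ => ENNReal.ofReal_ne_top, ← Finset.prod_pow]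
  refine Finset.prod_congr rfl fun i _ => ?_
  rw [← ENNReal.ofReal_rpow_of_nonneg (by positivity) (by positivity), ← sq_abs,
    ENNReal.ofReal_pow (abs_nonneg _), ← ENNReal.rpow_natCast, ← ENNReal.rpow_natCast,
    ← ENNReal.inv_rpow, ← ENNReal.inv_rpow, ← ENNReal.rpow_mul, ← ENNReal.rpow_mul,
    ← ENNReal.rpow_mul]
  congr 1
  push_cast
  ring

/-- Negative moments of a mean of squares of i.i.d. variables are bounded uniformly in the number
of summands. -/
theorem lintegral_inv_mean_sq_pow_le {ι Ω : Type*} [Fintype ι] [MeasurableSpace Ω] (μ : Measure Ω)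
    [IsProbabilityMeasure μ] {f : Ω → ℝ} (hf : Measurable f) (t : Finset ι) (q : ℕ)
    (ht : t.Nonempty) (hq : 4 * q ≤ t.card) :
    ∫⁻ x, (ENNReal.ofReal ((∑ i ∈ t, f (x i) ^ 2) / (t.card : ℝ)))⁻¹ ^ q
        ∂(Measure.pi fun _ : ι => μ) ≤
      (∫⁻ x, (ENNReal.ofReal |f x|)⁻¹ ^ (2⁻¹ : ℝ) ∂μ) ^ (4 * q) := by
  have hk : (0 : ℝ) < t.card := by exact_mod_cast ht.card_pos
  rcases Nat.eq_zero_or_pos q with rfl | hq0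
  · simp
  set h : Ω → ℝ≥0∞ := fun x => (ENNReal.ofReal |f x|)⁻¹ ^ (2⁻¹ : ℝ) with hh
  have hhm : Measurable h := by fun_prop
  -- AM-GM gives each factor |f|⁻¹ the exponent 2q/k, k the cardinality of t. This is r times 1/2,
  -- and r ≤ 1 by `hq`, so Jensen bounds each factor by the r-th power of the moment of order -1/2;
  -- the k powers multiply to the exponent 4q.
  set r : ℝ := 4 * q / t.card with hr
  have hr0 : 0 < r := by positivity
  have hr1 : r ≤ 1 := by
    rw [hr, div_le_one hk]; exact_mod_cast hq
  have hind : iIndepFun (fun (i : ι) (x : ι → Ω) => h (x i) ^ r) (Measure.pi fun _ : ι => μ) :=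
    iIndepFun_pi (X := fun _ x => h x ^ r) fun _ => (hhm.pow_const r).aemeasurable
  calc _ ≤ ∫⁻ x, ∏ i ∈ t, h (x i) ^ r ∂(Measure.pi fun _ : ι => μ) :=
        lintegral_mono fun x => inv_mean_sq_pow_le_prod t ht (fun i => f (x i)) q
    _ = ∏ i ∈ t, ∫⁻ x, h (x i) ^ r ∂(Measure.pi fun _ : ι => μ) :=
        lintegral_prod_eq_prod_lintegral_of_indepFun t _ hind
          fun i => (hhm.comp (measurable_pi_apply i)).pow_const r
    _ = ∏ i ∈ t, ∫⁻ x, h x ^ r ∂μ := Finset.prod_congr rfl fun i _ =>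
        (measurePreserving_eval (fun _ : ι => μ) i).lintegral_comp (hhm.pow_const r)
    _ ≤ ∏ i ∈ t, (∫⁻ x, h x ∂μ) ^ r :=
        Finset.prod_le_prod' fun _ _ => lintegral_rpow_le_rpow_lintegral μ hhm hr0 hr1
    _ = _ := by
        rw [Finset.prod_const, ← ENNReal.rpow_natCast, ← ENNReal.rpow_mul, ← ENNReal.rpow_natCast]
        congr 1
        rw [hr]; push_cast; field_simp

/-- Positive moments of a mean of squares. -/
theorem lintegral_mean_sq_pow_le {ι Ω : Type*} [Fintype ι] [MeasurableSpace Ω] (μ : Measure Ω)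
    [IsProbabilityMeasure μ] {f : Ω → ℝ} (hf : Measurable f) (t : Finset ι) {q : ℕ} (hq : q ≠ 0) :
    ∫⁻ x, ENNReal.ofReal (((∑ i ∈ t, f (x i) ^ 2) / (t.card : ℝ)) ^ q)
        ∂(Measure.pi fun _ : ι => μ) ≤
      ∫⁻ x, ENNReal.ofReal (f x ^ (2 * q)) ∂μ := by
  rcases t.eq_empty_or_nonempty with rfl | ht
  · simp [hq]
  have hk : (0 : ℝ) < t.card := by exact_mod_cast ht.card_pos
  have hpt : ∀ b : ι → ℝ, ENNReal.ofReal (((∑ i ∈ t, b i ^ 2) / (t.card : ℝ)) ^ q) ≤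
      ENNReal.ofReal (t.card : ℝ)⁻¹ * ∑ i ∈ t, ENNReal.ofReal (b i ^ (2 * q)) := by
    intro b
    have h1 := Real.pow_arith_mean_le_arith_mean_pow t (fun _ => (t.card : ℝ)⁻¹) (fun i => b i ^ 2)
      (fun _ _ => by positivity) (by simp [hk.ne']) (fun _ _ => by positivity) q
    rw [← Finset.mul_sum, ← Finset.mul_sum, inv_mul_eq_div] at h1
    rw [← ENNReal.ofReal_sum_of_nonneg fun i _ => (even_two_mul q).pow_nonneg _,
      ← ENNReal.ofReal_mul (by positivity)]
    refine ENNReal.ofReal_le_ofReal (h1.trans (le_of_eq ?_))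
    simp only [pow_mul]
  calc _ ≤ ∫⁻ x, ENNReal.ofReal (t.card : ℝ)⁻¹ * ∑ i ∈ t, ENNReal.ofReal (f (x i) ^ (2 * q))
          ∂(Measure.pi fun _ : ι => μ) := lintegral_mono fun x => hpt _
    _ = ENNReal.ofReal (t.card : ℝ)⁻¹ * ∑ i ∈ t, ∫⁻ x, ENNReal.ofReal (f (x i) ^ (2 * q))
          ∂(Measure.pi fun _ : ι => μ) := by
        rw [lintegral_const_mul' _ _ ENNReal.ofReal_ne_top, lintegral_finsetSum']
        intro i _
        exact (by fun_prop : Measurable _).aemeasurable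
    _ = ENNReal.ofReal (t.card : ℝ)⁻¹ * ∑ i ∈ t, ∫⁻ x, ENNReal.ofReal (f x ^ (2 * q)) ∂μ := by
        congr 1
        exact Finset.sum_congr rfl fun i _ =>
          (measurePreserving_eval (fun _ : ι => μ) i).lintegral_comp
            (f := fun x => ENNReal.ofReal (f x ^ (2 * q))) (by fun_prop)
    _ = _ := by
        rw [Finset.sum_const, nsmul_eq_mul, ← mul_assoc, ← ENNReal.ofReal_natCast,
          ← ENNReal.ofReal_mul (by positivity), inv_mul_cancel₀ hk.ne', ENNReal.ofReal_one, one_mul]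

/-! ### Moments of one-dimensional Gaussians -/

section RealGaussian

/-- The singularity |x|^(-1/2) is integrable at 0 and the Gaussian density is integrable at
infinity. The half-line integral is a known one, and symmetry gives the other half. -/
theorem lintegral_inv_sqrt_gaussianReal_zero_one_lt_top :
    ∫⁻ x, (ENNReal.ofReal |x|)⁻¹ ^ (2⁻¹ : ℝ) ∂(gaussianReal 0 1) < ∞ := by
  have hm : Measurable fun x : ℝ => (ENNReal.ofReal |x|)⁻¹ ^ (2⁻¹ : ℝ) := by fun_prop
  rw [gaussianReal_of_var_ne_zero _ one_ne_zero,
    lintegral_withDensity_eq_lintegral_mul _ (measurable_gaussianPDF _ _) hm]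
  simp only [Pi.mul_apply]
  set F : ℝ → ℝ≥0∞ := fun x => gaussianPDF 0 1 x * (ENNReal.ofReal |x|)⁻¹ ^ (2⁻¹ : ℝ) with hF
  have hFm : Measurable F := (measurable_gaussianPDF _ _).mul hm
  have hpos : ∫⁻ x in Set.Ioi (0 : ℝ), F x < ∞ := by
    have h1 := (integrableOn_rpow_mul_exp_neg_mul_sq (b := 2⁻¹) (by norm_num) (s := -2⁻¹)
      (by norm_num)).const_mul (√(2 * Real.pi))⁻¹
    refine lt_of_le_of_lt (le_of_eq ?_) h1.lintegral_lt_top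
    refine setLIntegral_congr_fun measurableSet_Ioi fun x (hx : 0 < x) => ?_
    simp only [hF, gaussianPDF, gaussianPDFReal]
    rw [abs_of_pos hx, ← ENNReal.ofReal_inv_of_pos hx,
      ENNReal.ofReal_rpow_of_nonneg (by positivity) (by norm_num),
      ← ENNReal.ofReal_mul (by positivity)]
    congr 1
    rw [Real.inv_rpow hx.le, Real.rpow_neg hx.le]
    simp only [NNReal.coe_one, mul_one, sub_zero]
    rw [show -x ^ 2 / 2 = -2⁻¹ * x ^ 2 by ring]
    ring
  have hneg : ∫⁻ x in Set.Iio (0 : ℝ), F x = ∫⁻ x in Set.Ioi (0 : ℝ), F x := by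
    have h2 := (Measure.measurePreserving_neg (volume : Measure ℝ)).setLIntegral_comp_preimage
      (measurableSet_Ioi (a := (0 : ℝ))) hFm
    rw [← h2]
    have h3 : Neg.neg ⁻¹' Set.Ioi (0 : ℝ) = Set.Iio 0 := by ext; simp
    rw [h3]
    refine lintegral_congr fun x => ?_
    simp [hF, gaussianPDF, gaussianPDFReal]
  have hsplit : ∫⁻ x, F x = (∫⁻ x in Set.Iic (0 : ℝ), F x) + ∫⁻ x in Set.Ioi (0 : ℝ), F x := by
    rw [← lintegral_add_compl F (measurableSet_Iic (a := (0 : ℝ))), Set.compl_Iic]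
  rw [hsplit, setLIntegral_congr Iio_ae_eq_Iic.symm, hneg]
  exact ENNReal.add_lt_top.2 ⟨hpos, hpos⟩

theorem lintegral_inv_sqrt_gaussianReal (v : ℝ≥0) (hv : v ≠ 0) :
    ∫⁻ x, (ENNReal.ofReal |x|)⁻¹ ^ (2⁻¹ : ℝ) ∂(gaussianReal 0 v) =
      (ENNReal.ofReal √v)⁻¹ ^ (2⁻¹ : ℝ) *
        ∫⁻ x, (ENNReal.ofReal |x|)⁻¹ ^ (2⁻¹ : ℝ) ∂(gaussianReal 0 1) := by
  have hv0 : (0 : ℝ) < v := by exact_mod_cast pos_iff_ne_zero.2 hv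
  have hs : 0 < √(v : ℝ) := Real.sqrt_pos.2 hv0
  have h1 : gaussianReal 0 v = (gaussianReal 0 1).map (√(v : ℝ) * ·) := by
    rw [gaussianReal_map_const_mul]
    congr 1
    · simp
    · ext; simp
  rw [h1, lintegral_map (by fun_prop) (by fun_prop), ← lintegral_const_mul _ (by fun_prop)]
  refine lintegral_congr fun x => ?_
  rw [abs_mul, abs_of_pos hs, ENNReal.ofReal_mul hs.le, ENNReal.mul_inv, ENNReal.mul_rpow_of_nonneg]
  · norm_num
  · left; simpa using hv0
  · left; exact ENNReal.ofReal_ne_top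

theorem lintegral_even_pow_gaussianReal_lt_top (v : ℝ≥0) (q : ℕ) :
    ∫⁻ x, ENNReal.ofReal (x ^ (2 * q)) ∂(gaussianReal 0 v) < ∞ := by
  have h := (memLp_id_gaussianReal (μ := 0) (v := v) (2 * q : ℕ)).integrable_norm_pow'
  have : Integrable (fun x : ℝ => x ^ (2 * q)) (gaussianReal 0 v) := by
    refine h.congr (ae_of_all _ fun x => ?_)
    simp [pow_mul]
  exact this.lintegral_lt_top

end RealGaussian

/-! ### Linear functionals of Gaussian vectors -/

section GaussianLaws

theorem map_add_prod_gaussianReal {Ω Ω' : Type*} [MeasurableSpace Ω] [MeasurableSpace Ω']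
    {μ : Measure Ω} {ρ : Measure Ω'} [IsProbabilityMeasure μ] [IsProbabilityMeasure ρ]
    {f : Ω → ℝ} {g : Ω' → ℝ} (hf : Measurable f) (hg : Measurable g) {a b : ℝ≥0}
    (hfa : μ.map f = gaussianReal 0 a) (hgb : ρ.map g = gaussianReal 0 b) :
    (μ.prod ρ).map (fun w => f w.1 + g w.2) = gaussianReal 0 (a + b) := by
  have h : (fun w : Ω × Ω' => f w.1 + g w.2) = (fun z : ℝ × ℝ => z.1 + z.2) ∘ Prod.map f g := rfl
  rw [h, ← Measure.map_map (by fun_prop) (by fun_prop), ← Measure.map_prod_map _ _ hf hg, hfa, hgb]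
  have hconv := gaussianReal_conv_gaussianReal (m₁ := 0) (m₂ := 0) (v₁ := a) (v₂ := b)
  rwa [add_zero] at hconv

theorem map_fst_prod_of_isProbabilityMeasure {Ω Ω' : Type*} [MeasurableSpace Ω]
    [MeasurableSpace Ω'] {μ : Measure Ω} {ρ : Measure Ω'} [IsProbabilityMeasure μ]
    [IsProbabilityMeasure ρ] {f : Ω → ℝ} (hf : Measurable f) :
    (μ.prod ρ).map (fun w => f w.1) = μ.map f := by
  have h : (fun w : Ω × Ω' => f w.1) = f ∘ Prod.fst := rfl
  rw [h, ← Measure.map_map hf measurable_fst, Measure.map_fst_prod]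
  simp

theorem measurable_dotProduct_const {k : ℕ} (u : Fin k → ℝ) :
    Measurable fun z : Fin k → ℝ => z ⬝ᵥ u := by
  unfold dotProduct
  fun_prop

instance isProbabilityMeasure_centeredGaussian {k : ℕ} (S : Matrix (Fin k) (Fin k) ℝ) :
    IsProbabilityMeasure (centeredGaussian S) :=
  Measure.isProbabilityMeasure_map (by fun_prop)

theorem map_dotProduct_centeredGaussian {k : ℕ} {S : Matrix (Fin k) (Fin k) ℝ}
    (hS : S.PosSemidef) (u : Fin k → ℝ) :
    (centeredGaussian S).map (fun z => z ⬝ᵥ u) = gaussianReal 0 (u ⬝ᵥ S *ᵥ u).toNNReal := by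
  rw [centeredGaussian, Measure.map_map (measurable_dotProduct_const u) (by fun_prop)]
  have h : (fun z => z ⬝ᵥ u) ∘ (WithLp.ofLp : EuclideanSpace ℝ (Fin k) → Fin k → ℝ) =
      innerSL ℝ (WithLp.toLp 2 u) := by
    ext z
    simp [PiLp.inner_apply, dotProduct]
  rw [h, IsGaussian.map_eq_gaussianReal]
  congr 1
  · rw [ContinuousLinearMap.integral_comp_id_comm IsGaussian.integrable_id]
    simp
  · congr 1
    have := covarianceBilin_self (μ := multivariateGaussian 0 S) IsGaussian.memLp_two_id
      (WithLp.toLp 2 u)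
    rw [covarianceBilin_multivariateGaussian hS] at this
    exact this.symm

end GaussianLaws

/-! ### Marginals of the observational law and the interventional regression -/

namespace LinearGaussianSEM

variable {p d : ℕ} (M : LinearGaussianSEM p d)

/-- The variance of `Zᵀγ + N_Y`, the noise of the interventional regression. -/
noncomputable def noiseVar : ℝ≥0 := (M.γ ⬝ᵥ M.covZ *ᵥ M.γ).toNNReal + M.varY

theorem measurable_obsMap : Measurable fun w : (Fin d → ℝ) × (Fin p → ℝ) × ℝ =>
    (M.B *ᵥ w.1 + w.2.1, M.outcome w.1 (M.B *ᵥ w.1 + w.2.1) w.2.2) := by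
  unfold outcome mulVec dotProduct
  fun_prop

instance isProbabilityMeasure_obsLaw : IsProbabilityMeasure M.obsLaw :=
  Measure.isProbabilityMeasure_map M.measurable_obsMap.aemeasurable

/-- Since v·(BZ + N_X) = Bᵀv·Z + v·N_X, this is a sum of two independent centred Gaussians. -/
theorem map_dotProduct_obsLaw (v : Fin p → ℝ) :
    M.obsLaw.map (fun s => s.1 ⬝ᵥ v) =
      gaussianReal 0 (v ⬝ᵥ (M.covX + M.B * M.covZ * M.Bᵀ) *ᵥ v).toNNReal := by
  have hm : Measurable fun s : (Fin p → ℝ) × ℝ => s.1 ⬝ᵥ v :=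
    (measurable_dotProduct_const v).comp measurable_fst
  rw [obsLaw, Measure.map_map hm M.measurable_obsMap]
  have h : (fun s : (Fin p → ℝ) × ℝ => s.1 ⬝ᵥ v) ∘ (fun w : (Fin d → ℝ) × (Fin p → ℝ) × ℝ =>
      (M.B *ᵥ w.1 + w.2.1, M.outcome w.1 (M.B *ᵥ w.1 + w.2.1) w.2.2)) =
      fun w => (fun z => z ⬝ᵥ (M.Bᵀ *ᵥ v)) w.1 + (fun y => y.1 ⬝ᵥ v) w.2 := by
    ext w
    simp only [Function.comp, add_dotProduct]
    rw [dotProduct_comm w.1, transpose_mulVec_dotProduct, dotProduct_comm v]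
  rw [h]
  refine (map_add_prod_gaussianReal (measurable_dotProduct_const _)
    ((measurable_dotProduct_const v).comp measurable_fst)
    (map_dotProduct_centeredGaussian M.covZ_posSemidef _)
    ((map_fst_prod_of_isProbabilityMeasure (measurable_dotProduct_const v)).trans
      (map_dotProduct_centeredGaussian M.covX_posSemidef v))).trans ?_
  rw [← Real.toNNReal_add (posSemidef_dotProduct_mulVec_nonneg M.covZ_posSemidef _)
    (posSemidef_dotProduct_mulVec_nonneg M.covX_posSemidef _)]
  congr 2
  rw [transpose_mulVec_dotProduct, add_mulVec, dotProduct_add, add_comm]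
  simp only [mulVec_mulVec, Matrix.mul_assoc]

/-- Y = Z·(γ + Bᵀα) + N_X·α + N_Y is a sum of independent centred Gaussians. Only finiteness of its
moments is wanted, so the variance is left unspecified. -/
theorem exists_map_snd_obsLaw : ∃ a : ℝ≥0, M.obsLaw.map Prod.snd = gaussianReal 0 a := by
  rw [obsLaw, Measure.map_map measurable_snd M.measurable_obsMap]
  have h : Prod.snd ∘ (fun w : (Fin d → ℝ) × (Fin p → ℝ) × ℝ =>
      (M.B *ᵥ w.1 + w.2.1, M.outcome w.1 (M.B *ᵥ w.1 + w.2.1) w.2.2)) =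
      fun w => (fun z => z ⬝ᵥ (M.γ + M.Bᵀ *ᵥ M.α)) w.1 +
        (fun y : (Fin p → ℝ) × ℝ => (fun x => x ⬝ᵥ M.α) y.1 + (fun t => t) y.2) w.2 := by
    ext w
    simp only [Function.comp, outcome, add_dotProduct, dotProduct_add]
    rw [dotProduct_comm w.1 (M.Bᵀ *ᵥ M.α), transpose_mulVec_dotProduct, dotProduct_comm M.α]
    ring
  rw [h]
  exact ⟨_, map_add_prod_gaussianReal (measurable_dotProduct_const _)
    (((measurable_dotProduct_const M.α).comp measurable_fst).add measurable_snd)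
    (map_dotProduct_centeredGaussian M.covZ_posSemidef _)
    (map_add_prod_gaussianReal (measurable_dotProduct_const M.α) measurable_id
      (map_dotProduct_centeredGaussian M.covX_posSemidef M.α) Measure.map_id)⟩

variable (ν : Measure (Fin p → ℝ)) [IsProbabilityMeasure ν]

/-- The interventional law is a regression of `Y` on `X` with independent Gaussian noise. -/
theorem intLaw_eq_map : M.intLaw ν = (ν.prod (gaussianReal 0 M.noiseVar)).map
    fun w => (w.1, w.1 ⬝ᵥ M.α + w.2) := by
  have hout : Measurable fun w : (Fin p → ℝ) × ℝ => (w.1, w.1 ⬝ᵥ M.α + w.2) :=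
    measurable_fst.prodMk (((measurable_dotProduct_const M.α).comp measurable_fst).add
      measurable_snd)
  have hg : Measurable fun w : (Fin d → ℝ) × ℝ => w.1 ⬝ᵥ M.γ + w.2 :=
    ((measurable_dotProduct_const M.γ).comp measurable_fst).add measurable_snd
  have hnoise : gaussianReal 0 M.noiseVar =
      ((centeredGaussian M.covZ).prod (gaussianReal 0 M.varY)).map
        fun w => w.1 ⬝ᵥ M.γ + w.2 :=
    (map_add_prod_gaussianReal (measurable_dotProduct_const M.γ) measurable_id
      (map_dotProduct_centeredGaussian M.covZ_posSemidef M.γ) Measure.map_id).symm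
  -- Reordering (Z, X, N_Y) as (X, (Z, N_Y)) isolates the noise Zᵀγ + N_Y, which is independent of
  -- the randomized X.
  have hre : MeasurePreserving
      (fun w : (Fin d → ℝ) × (Fin p → ℝ) × ℝ => (w.2.1, (w.1, w.2.2)))
      ((centeredGaussian M.covZ).prod (ν.prod (gaussianReal 0 M.varY)))
      (ν.prod ((centeredGaussian M.covZ).prod (gaussianReal 0 M.varY))) :=
    (measurePreserving_prodAssoc ν (centeredGaussian M.covZ) (gaussianReal 0 M.varY)).comp
      (((Measure.measurePreserving_swap (μ := centeredGaussian M.covZ) (ν := ν)).prod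
        (MeasurePreserving.id (gaussianReal 0 M.varY))).comp
        ((measurePreserving_prodAssoc (centeredGaussian M.covZ) ν
          (gaussianReal 0 M.varY)).symm MeasurableEquiv.prodAssoc))
  have hmp : ν.prod (gaussianReal 0 M.noiseVar) =
      (ν.prod ((centeredGaussian M.covZ).prod (gaussianReal 0 M.varY))).map
        (Prod.map id fun w => w.1 ⬝ᵥ M.γ + w.2) := by
    rw [← Measure.map_prod_map _ _ measurable_id hg, Measure.map_id, ← hnoise]
  rw [hmp, ← hre.map_eq, Measure.map_map (measurable_id.prodMap hg) hre.measurable,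
    Measure.map_map hout ((measurable_id.prodMap hg).comp hre.measurable), intLaw]
  congr 1
  ext w
  · simp
  · simp only [Function.comp, outcome, Prod.map, id]
    ring

/-- Conditioning on the design. The inequality holds for every F, measurable or not, and is the only
direction needed. -/
theorem lintegral_pi_intLaw_le (m : ℕ) (F : (Fin m → (Fin p → ℝ) × ℝ) → ℝ≥0∞) :
    ∫⁻ s, F s ∂(Measure.pi fun _ : Fin m => M.intLaw ν) ≤
      ∫⁻ x, ∫⁻ e, F (fun i => (x i, x i ⬝ᵥ M.α + e i))
        ∂(Measure.pi fun _ : Fin m => gaussianReal 0 M.noiseVar)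
        ∂(Measure.pi fun _ : Fin m => ν) := by
  have hout : Measurable fun w : (Fin p → ℝ) × ℝ => (w.1, w.1 ⬝ᵥ M.α + w.2) :=
    measurable_fst.prodMk (((measurable_dotProduct_const M.α).comp measurable_fst).add
      measurable_snd)
  have h1 : (Measure.pi fun _ : Fin m => M.intLaw ν) =
      (Measure.pi fun _ : Fin m => ν.prod (gaussianReal 0 M.noiseVar)).map
        fun x i => ((x i).1, (x i).1 ⬝ᵥ M.α + (x i).2) := by
    rw [M.intLaw_eq_map ν]
    exact (Measure.pi_map_pi fun _ => hout.aemeasurable).symm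
  have h2 := (measurePreserving_arrowProdEquivProdArrow (Fin p → ℝ) ℝ (Fin m) (fun _ => ν)
    (fun _ => gaussianReal 0 M.noiseVar)).symm
  rw [h1]
  refine (lintegral_map_le _ _).trans ?_
  rw [← h2.map_eq]
  refine (lintegral_map_le _ _).trans ?_
  exact lintegral_prod_le _

end LinearGaussianSEM

/-! ### Least squares as an orthogonal projection -/

section Projection

theorem sqNorm_ofLp {m : ℕ} (v : EuclideanSpace ℝ (Fin m)) : sqNorm v.ofLp = ‖v‖ ^ 2 := by
  rw [EuclideanSpace.real_norm_sq_eq, sqNorm]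

theorem sqNorm_ofLp_sum {m : ℕ} {ι : Type*} [Fintype ι]
    (b : OrthonormalBasis ι ℝ (EuclideanSpace ℝ (Fin m))) (t : Finset ι) (x : ι → ℝ) :
    sqNorm (∑ i ∈ t, x i • b i).ofLp = ∑ i ∈ t, x i ^ 2 := by
  rw [sqNorm_ofLp, ← real_inner_self_eq_norm_sq, b.orthonormal.inner_sum]
  simp [sq]

/-- An orthonormal basis adapted to the column space of a design: the fitted values and the
residuals of a noise vector are read off from its coordinates. -/
theorem exists_orthonormalBasis_fit {m p : ℕ} {X : Matrix (Fin m) (Fin p) ℝ}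
    (hX : IsUnit (Xᵀ * X).det) :
    ∃ (ι : Type) (_ : Fintype ι) (_ : DecidableEq ι) (t : Finset ι)
      (b : OrthonormalBasis ι ℝ (EuclideanSpace ℝ (Fin m))), t.card = p ∧ Fintype.card ι = m ∧
      ∀ (c : ℝ) (x : ι → ℝ),
        sqNorm (X *ᵥ ols X (c • ∑ i, x i • b i).ofLp) = c ^ 2 * ∑ i ∈ t, x i ^ 2 ∧
        sqNorm ((c • ∑ i, x i • b i).ofLp - X *ᵥ ols X (c • ∑ i, x i • b i).ofLp) =
          c ^ 2 * ∑ i ∈ tᶜ, x i ^ 2 := by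
  set L := Matrix.toLpLin 2 2 X with hL
  have hLapp : ∀ v, L v = WithLp.toLp 2 (X *ᵥ v.ofLp) := fun v => by
    rw [hL, Matrix.toLpLin_apply]
  have hinv : ∀ a : Fin p → ℝ, ols X (X *ᵥ a) = a := fun a => by
    have := ols_add hX a 0
    rw [add_zero] at this
    rw [this, ols]; simp
  have hLinj : Function.Injective L := fun v w h => by
    rw [hLapp, hLapp] at h
    have h1 := congrArg (fun z => ols X (WithLp.ofLp z)) h
    simp only [hinv] at h1
    exact WithLp.ofLp_injective 2 h1
  set U := LinearMap.range L with hU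
  have hUdim : Module.finrank ℝ U = p := by
    rw [hU, LinearMap.finrank_range_of_inj hLinj, finrank_euclideanSpace_fin]
  set H : Matrix (Fin m) (Fin m) ℝ := X * ((Xᵀ * X)⁻¹ * Xᵀ) with hH
  have hfit : ∀ e, X *ᵥ ols X e = H *ᵥ e := fun e => by
    rw [hH, ols, mulVec_mulVec, mulVec_mulVec, Matrix.mul_assoc]
  have hmem : ∀ u ∈ U, H *ᵥ u.ofLp = u.ofLp := by
    rintro _ ⟨a, rfl⟩
    rw [hLapp, ← hfit]
    simp only [hinv]
  have hperp : ∀ u ∈ Uᗮ, H *ᵥ u.ofLp = 0 := by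
    intro u hu
    have h0 : Xᵀ *ᵥ u.ofLp = 0 := by
      rw [← sqNorm_eq_zero, sqNorm_eq_dotProduct, transpose_mulVec_dotProduct]
      have := (Submodule.mem_orthogonal _ _).1 hu (L (WithLp.toLp 2 (Xᵀ *ᵥ u.ofLp))) ⟨_, rfl⟩
      rw [hLapp] at this
      simpa [PiLp.inner_apply, dotProduct] using this
    rw [hH, ← mulVec_mulVec, ← mulVec_mulVec, h0]
    simp
  -- The hat matrix H is the identity on the column space U and zero on its orthogonal complement.
  -- Gluing orthonormal bases of the two makes fitting the restriction to the coordinates in t.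
  set b := ((stdOrthonormalBasis ℝ U).prod (stdOrthonormalBasis ℝ Uᗮ)).map
    U.orthogonalDecomposition.symm with hb
  have hbl : ∀ i, b (Sum.inl i) ∈ U := fun i => by simp [hb]
  have hbr : ∀ i, b (Sum.inr i) ∈ Uᗮ := fun i => by simp [hb]
  set t : Finset (Fin (Module.finrank ℝ U) ⊕ Fin (Module.finrank ℝ Uᗮ)) :=
    Finset.univ.map Function.Embedding.inl with ht
  have hlin : ∀ x : _ → ℝ, H *ᵥ (∑ i, x i • b i).ofLp = (∑ i ∈ t, x i • b i).ofLp := by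
    intro x
    set T := Matrix.toLpLin 2 2 H with hT
    have hTapp : ∀ v, T v = WithLp.toLp 2 (H *ᵥ v.ofLp) := fun v => by
      rw [hT, Matrix.toLpLin_apply]
    have hTl : ∀ i, T (b (Sum.inl i)) = b (Sum.inl i) := fun i => by
      rw [hTapp, hmem _ (hbl i)]
    have hTr : ∀ i, T (b (Sum.inr i)) = 0 := fun i => by
      rw [hTapp, hperp _ (hbr i), WithLp.toLp_zero]
    have hsum : T (∑ i, x i • b i) = ∑ i ∈ t, x i • b i := by
      rw [map_sum, Fintype.sum_sum_type, ht, Finset.sum_map]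
      simp only [map_smul, hTl, hTr, smul_zero, Finset.sum_const_zero, add_zero,
        Function.Embedding.inl_apply]
    rw [← hsum, hTapp]
  refine ⟨_, inferInstance, inferInstance, t, b, by simp [ht, hUdim], ?_, fun c x => ?_⟩
  · rw [← Module.finrank_eq_card_basis b.toBasis, finrank_euclideanSpace_fin]
  · have h1 : X *ᵥ ols X (c • ∑ i, x i • b i).ofLp = c • (∑ i ∈ t, x i • b i).ofLp := by
      rw [hfit, WithLp.ofLp_smul, mulVec_smul, hlin]
    have h2 : (c • ∑ i, x i • b i).ofLp - X *ᵥ ols X (c • ∑ i, x i • b i).ofLp =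
        c • (∑ i ∈ tᶜ, x i • b i).ofLp := by
      rw [h1, WithLp.ofLp_smul, ← smul_sub, ← WithLp.ofLp_sub, ← Finset.sum_add_sum_compl t]
      simp
    rw [h2, h1, sqNorm_smul, sqNorm_smul, sqNorm_ofLp_sum, sqNorm_ofLp_sum]
    exact ⟨rfl, rfl⟩

end Projection

/-! ### Moments of the fitted and residual noise, uniform in the design -/

section NoiseMoments

/-- Rotation invariance: the coordinates of white noise in any orthonormal basis, in particular one
adapted to the design, are again i.i.d. Gaussian. -/
theorem lintegral_pi_gaussianReal_eq {m : ℕ} {ι : Type*} [Fintype ι] (v : ℝ≥0)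
    (b : OrthonormalBasis ι ℝ (EuclideanSpace ℝ (Fin m))) {F : (Fin m → ℝ) → ℝ≥0∞}
    (hF : Measurable F) :
    ∫⁻ e, F e ∂(Measure.pi fun _ : Fin m => gaussianReal 0 v) =
      ∫⁻ x, F (√(v : ℝ) • ∑ i, x i • b i).ofLp ∂(Measure.pi fun _ : ι => gaussianReal 0 1) := by
  have h1 : gaussianReal 0 v = (gaussianReal 0 1).map (√(v : ℝ) * ·) := by
    rw [gaussianReal_map_const_mul]
    congr 1
    · simp
    · ext; simp
  have h2 : (Measure.pi fun _ : Fin m => gaussianReal 0 v) =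
      (Measure.pi fun _ : Fin m => gaussianReal 0 1).map fun x i => √(v : ℝ) * x i := by
    rw [h1]
    exact (Measure.pi_map_pi fun _ => by fun_prop).symm
  have h3 := stdGaussian_eq_map_pi_orthonormalBasis b
  rw [← map_pi_eq_stdGaussian] at h3
  have h4 : (Measure.pi fun _ : Fin m => gaussianReal 0 1) =
      (Measure.pi fun _ : ι => gaussianReal 0 1).map fun x => (∑ i, x i • b i).ofLp := by
    have := congrArg (Measure.map WithLp.ofLp) h3
    rw [Measure.map_map (by fun_prop) (by fun_prop), Measure.map_map (by fun_prop) (by fun_prop)]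
      at this
    rw [← Measure.map_id (μ := Measure.pi fun _ : Fin m => gaussianReal 0 1)]
    exact this
  have hs : Measurable fun (x : Fin m → ℝ) i => √(v : ℝ) * x i := by fun_prop
  have hb : Measurable fun x : ι → ℝ => (∑ i, x i • b i).ofLp := by fun_prop
  rw [h2, lintegral_map hF hs, h4]
  exact lintegral_map (hF.comp hs) hb

theorem measurable_sqNorm_fit {m p : ℕ} (X : Matrix (Fin m) (Fin p) ℝ) :
    Measurable fun e : Fin m → ℝ => sqNorm (X *ᵥ ols X e) := by
  refine Continuous.measurable ?_
  unfold sqNorm ols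
  have : Continuous fun e : Fin m → ℝ => X *ᵥ ((Xᵀ * X)⁻¹ *ᵥ (Xᵀ *ᵥ e)) := by fun_prop
  fun_prop

theorem measurable_varHat {m p : ℕ} (X : Matrix (Fin m) (Fin p) ℝ) :
    Measurable fun e : Fin m → ℝ => varHat X e := by
  refine Continuous.measurable ?_
  unfold varHat sqNorm ols
  have : Continuous fun e : Fin m → ℝ => e - X *ᵥ ((Xᵀ * X)⁻¹ *ᵥ (Xᵀ *ᵥ e)) := by fun_prop
  fun_prop

/-- In an adapted basis the fitted noise has exactly p Gaussian coordinates, so the law of its norm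
depends neither on m nor on the design. The factor 32 is 2⁵, from (1 + x)⁶ ≤ 2⁵(1 + x⁶). -/
theorem exists_lintegral_fit_le (p : ℕ) (v : ℝ≥0) :
    ∃ K : ℝ≥0∞, K < ∞ ∧ ∀ {m : ℕ} {X : Matrix (Fin m) (Fin p) ℝ}, IsUnit (Xᵀ * X).det →
      ∫⁻ e, ENNReal.ofReal ((1 + sqNorm (X *ᵥ ols X e)) ^ 6)
        ∂(Measure.pi fun _ : Fin m => gaussianReal 0 v) ≤ K := by
  set C := ∫⁻ x, ENNReal.ofReal (x ^ (2 * 6)) ∂(gaussianReal 0 1)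
  have hC : C < ∞ := lintegral_even_pow_gaussianReal_lt_top 1 6
  set B : ℝ := (v * p) ^ 6
  refine ⟨32 * (1 + ENNReal.ofReal B * C), ?_, fun {m X} hX => ?_⟩
  · exact ENNReal.mul_lt_top (by simp) (ENNReal.add_lt_top.2
      ⟨by simp, ENNReal.mul_lt_top ENNReal.ofReal_lt_top hC⟩)
  obtain ⟨ι, _, _, t, b, htp, -, hb⟩ := exists_orthonormalBasis_fit hX
  have hm := measurable_sqNorm_fit X
  rw [lintegral_pi_gaussianReal_eq v b (by fun_prop)]
  simp only [(hb _ _).1]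
  calc _ ≤ ∫⁻ x, 32 * (1 + ENNReal.ofReal B *
          ENNReal.ofReal (((∑ i ∈ t, x i ^ 2) / (t.card : ℝ)) ^ 6))
          ∂(Measure.pi fun _ : ι => gaussianReal 0 1) := by
        refine lintegral_mono fun x => ?_
        have h0 : (√(v : ℝ)) ^ 2 * ∑ i ∈ t, x i ^ 2 =
            v * p * ((∑ i ∈ t, x i ^ 2) / (t.card : ℝ)) := by
          rw [Real.sq_sqrt (NNReal.coe_nonneg v)]
          -- For p = 0 the mean over the empty set t reads 0/0 = 0 and both sides vanish.
          rcases Nat.eq_zero_or_pos p with hp | hp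
          · rw [hp, Finset.card_eq_zero] at htp
            simp [htp, hp]
          · rw [htp]
            have : (p : ℝ) ≠ 0 := by exact_mod_cast hp.ne'
            field_simp
        simp only
        rw [h0]
        set y := (∑ i ∈ t, x i ^ 2) / (t.card : ℝ)
        have hy : 0 ≤ y := by positivity
        rw [← ENNReal.ofReal_mul (by positivity), ← ENNReal.ofReal_one,
          ← ENNReal.ofReal_add (by positivity) (by positivity),
          show (32 : ℝ≥0∞) = ENNReal.ofReal 32 by simp, ← ENNReal.ofReal_mul (by positivity)]
        refine ENNReal.ofReal_le_ofReal ?_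
        have := add_pow_le (a := 1) (b := v * p * y) (by positivity) (by positivity) 6
        rw [← mul_pow]
        norm_num at this ⊢
        linarith
    _ = 32 * (1 + ENNReal.ofReal B * ∫⁻ x, ENNReal.ofReal (((∑ i ∈ t, x i ^ 2) /
          (t.card : ℝ)) ^ 6) ∂(Measure.pi fun _ : ι => gaussianReal 0 1)) := by
        rw [lintegral_const_mul' _ _ (by simp), lintegral_add_left measurable_const,
          lintegral_const_mul' _ _ ENNReal.ofReal_ne_top]
        simp
    _ ≤ _ := by
        gcongr
        exact lintegral_mean_sq_pow_le (gaussianReal 0 1) measurable_id t (by norm_num)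

theorem exists_lintegral_varHat_le (p : ℕ) (v : ℝ≥0) :
    ∃ K : ℝ≥0∞, K < ∞ ∧ ∀ {m : ℕ} {X : Matrix (Fin m) (Fin p) ℝ}, 2 ≤ m → IsUnit (Xᵀ * X).det →
      ∫⁻ e, ENNReal.ofReal (varHat X e ^ 4)
        ∂(Measure.pi fun _ : Fin m => gaussianReal 0 v) ≤ K := by
  set C := ∫⁻ x, ENNReal.ofReal (x ^ (2 * 4)) ∂(gaussianReal 0 v)
  have hC : C < ∞ := lintegral_even_pow_gaussianReal_lt_top v 4
  refine ⟨16 * C, ENNReal.mul_lt_top (by simp) hC, fun {m X} hm hX => ?_⟩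
  have hmean := lintegral_mean_sq_pow_le (gaussianReal 0 v) measurable_id
    (Finset.univ : Finset (Fin m)) (q := 4) (by norm_num)
  refine le_trans ?_ (mul_le_mul_right hmean 16)
  rw [← lintegral_const_mul' _ _ (by simp)]
  refine lintegral_mono fun e => ?_
  rw [show (16 : ℝ≥0∞) = ENNReal.ofReal 16 by simp, ← ENNReal.ofReal_mul (by positivity)]
  refine ENNReal.ofReal_le_ofReal ?_
  have h1 := pow_le_pow_left₀ (varHat_nonneg X e) (varHat_le hX hm e) 4
  rw [mul_pow] at h1
  norm_num at h1 ⊢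
  exact h1

/-- The residual is a sum of squares of m - p independent Gaussians. The condition 2p + 8 ≤ m
secures m - p ≥ 8 = 4·2, as the negative second moment requires, and m - 1 ≤ 2(m - p), which
accounts for v/2 in place of v. -/
theorem exists_lintegral_inv_varHat_le (p : ℕ) {v : ℝ≥0} (hv : v ≠ 0) :
    ∃ K : ℝ≥0∞, K < ∞ ∧ ∀ {m : ℕ} {X : Matrix (Fin m) (Fin p) ℝ}, 2 * p + 8 ≤ m →
      IsUnit (Xᵀ * X).det →
      ∫⁻ e, (ENNReal.ofReal (varHat X e))⁻¹ ^ 2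
        ∂(Measure.pi fun _ : Fin m => gaussianReal 0 v) ≤ K := by
  have hv0 : (0 : ℝ) < v := by exact_mod_cast pos_iff_ne_zero.2 hv
  set C := ∫⁻ x, (ENNReal.ofReal |x|)⁻¹ ^ (2⁻¹ : ℝ) ∂(gaussianReal 0 1)
  have hC : C < ∞ := lintegral_inv_sqrt_gaussianReal_zero_one_lt_top
  set B : ℝ≥0∞ := (ENNReal.ofReal (v / 2))⁻¹ ^ 2
  have hB : B < ∞ := by
    refine ENNReal.pow_lt_top ?_
    rw [ENNReal.inv_lt_top]
    simpa using hv0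
  refine ⟨B * C ^ (4 * 2), ENNReal.mul_lt_top hB (ENNReal.pow_lt_top hC), fun {m X} hm hX => ?_⟩
  obtain ⟨ι, _, _, t, b, htp, hι, hb⟩ := exists_orthonormalBasis_fit hX
  have hmeas := measurable_varHat X
  have hcard : (tᶜ.card : ℝ) = m - p := by
    rw [Finset.card_compl, htp, hι, Nat.cast_sub (by omega)]
  have hcardN : tᶜ.card = m - p := by rw [Finset.card_compl, htp, hι]
  have hm' : (2 * p + 8 : ℝ) ≤ m := by exact_mod_cast hm
  have hp0 : (0 : ℝ) ≤ p := by positivity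
  rw [lintegral_pi_gaussianReal_eq v b (by fun_prop)]
  have hmean := lintegral_inv_mean_sq_pow_le (gaussianReal 0 1) measurable_id tᶜ 2
    (Finset.card_pos.1 (by omega)) (by omega)
  refine le_trans ?_ (mul_le_mul_right hmean B)
  rw [← lintegral_const_mul' _ _ hB.ne]
  refine lintegral_mono fun x => ?_
  simp only [varHat, (hb _ _).2, id]
  rw [← mul_pow, ← ENNReal.mul_inv (Or.inr ENNReal.ofReal_ne_top) (Or.inl ENNReal.ofReal_ne_top),
    ← ENNReal.ofReal_mul (by positivity)]
  refine pow_le_pow_left' (ENNReal.inv_le_inv.2 (ENNReal.ofReal_le_ofReal ?_)) 2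
  rw [hcard, Real.sq_sqrt (NNReal.coe_nonneg v)]
  set T := ∑ i ∈ tᶜ, x i ^ 2
  have hT : 0 ≤ T := by positivity
  rw [one_div_mul_eq_div, div_mul_div_comm, div_le_div_iff₀ (by linarith) (by linarith)]
  have : 0 ≤ (v : ℝ) * T := by positivity
  nlinarith

end NoiseMoments

/-- A positive definite quadratic form on `ℝ^p` is coercive. -/
theorem exists_coercive_of_pos {p : ℕ} {S : Matrix (Fin p) (Fin p) ℝ}
    (hS : ∀ v, v ≠ 0 → 0 < v ⬝ᵥ (S *ᵥ v)) :
    ∃ c : ℝ, 0 < c ∧ ∀ v, c * sqNorm v ≤ v ⬝ᵥ (S *ᵥ v) := by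
  set K : Set (Fin p → ℝ) := {v | sqNorm v = 1} with hK
  have hcont : Continuous fun v : Fin p → ℝ => sqNorm v := by unfold sqNorm; fun_prop
  have hquad : Continuous fun v : Fin p → ℝ => v ⬝ᵥ (S *ᵥ v) := by fun_prop
  have hKc : IsCompact K := by
    refine Metric.isCompact_of_isClosed_isBounded (isClosed_eq hcont continuous_const) ?_
    refine (Metric.isBounded_closedBall (x := (0 : Fin p → ℝ)) (r := 1)).subset fun v hv => ?_
    rw [mem_closedBall_zero_iff, pi_norm_le_iff_of_nonneg zero_le_one]
    intro i
    have h1 : v i ^ 2 ≤ sqNorm v :=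
      Finset.single_le_sum (f := fun i => v i ^ 2) (fun _ _ => sq_nonneg _) (Finset.mem_univ i)
    rw [show sqNorm v = 1 from hv] at h1
    rw [Real.norm_eq_abs]
    exact abs_le_one_iff_mul_self_le_one.2 (by nlinarith)
  have hscale : ∀ c : ℝ, (∀ v ∈ K, c ≤ v ⬝ᵥ (S *ᵥ v)) → ∀ v, c * sqNorm v ≤ v ⬝ᵥ (S *ᵥ v) := by
    intro c hc v
    rcases eq_or_ne v 0 with rfl | hv
    · simp
    have hpos : 0 < sqNorm v := lt_of_le_of_ne (sqNorm_nonneg v) fun h => hv (sqNorm_eq_zero.1 h.symm)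
    have hr : 0 < √(sqNorm v) := Real.sqrt_pos.2 hpos
    have hu := hc ((√(sqNorm v))⁻¹ • v) (by
      change sqNorm _ = 1
      rw [sqNorm_smul, inv_pow, Real.sq_sqrt hpos.le]
      exact inv_mul_cancel₀ hpos.ne')
    rw [mulVec_smul, smul_dotProduct, dotProduct_smul, smul_smul, ← sq, inv_pow,
      Real.sq_sqrt hpos.le, smul_eq_mul, inv_mul_eq_div, le_div_iff₀ hpos] at hu
    exact hu
  rcases K.eq_empty_or_nonempty with hKe | hKne
  · exact ⟨1, one_pos, hscale 1 fun v hv => by rw [hKe] at hv; exact hv.elim⟩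
  · obtain ⟨v₀, hv₀, hmin⟩ := hKc.exists_isMinOn hKne hquad.continuousOn
    refine ⟨v₀ ⬝ᵥ (S *ᵥ v₀), hS v₀ ?_, hscale _ fun v hv => hmin hv⟩
    rintro rfl
    simp [hK] at hv₀

/-! ### Controlling the least eigenvalue by an integral over directions -/

section NegativeMoments

variable {n p : ℕ}

theorem sqNorm_mulVec_le (X : Matrix (Fin n) (Fin p) ℝ) (v : Fin p → ℝ) :
    sqNorm (X *ᵥ v) ≤ (∑ i, sqNorm (X i)) * sqNorm v := by
  rw [sqNorm, Finset.sum_mul]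
  exact Finset.sum_le_sum fun i _ => sq_dotProduct_le (X i) v

/-- The shell `1/2 ≤ ‖v‖ ≤ 2` in `ℝ^p`. -/
def shell (p : ℕ) : Set (EuclideanSpace ℝ (Fin p)) := {v | 1 / 2 ≤ ‖v‖ ∧ ‖v‖ ≤ 2}

theorem measurableSet_shell (p : ℕ) : MeasurableSet (shell p) :=
  (measurableSet_le measurable_const measurable_norm).inter
    (measurableSet_le measurable_norm measurable_const)

theorem volume_shell_lt_top (p : ℕ) : volume (shell p) < ∞ := by
  refine lt_of_le_of_lt (measure_mono fun v hv => ?_)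
    (measure_closedBall_lt_top (x := (0 : EuclideanSpace ℝ (Fin p))) (r := 2))
  simpa using hv.2

/-- If a design nearly annihilates a unit vector, then it is small on a whole ball around it. -/
theorem inv_pow_le_mul_lintegral_shell (q : ℕ) (hn : 0 < n) (X : Matrix (Fin n) (Fin p) ℝ)
    {u : Fin p → ℝ} (hu : sqNorm u = 1) (hXu : 0 < sqNorm (X *ᵥ u)) :
    (ENNReal.ofReal (sqNorm (X *ᵥ u) / n))⁻¹ ^ q ≤
      ENNReal.ofReal (4 ^ (p + q) * 2 ^ p) *
        (volume (Metric.ball (0 : EuclideanSpace ℝ (Fin p)) 1))⁻¹ *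
        (ENNReal.ofReal ((1 + (∑ i, sqNorm (X i)) / n) ^ p) *
          ∫⁻ v in shell p, (ENNReal.ofReal (sqNorm (X *ᵥ v.ofLp) / n))⁻¹ ^ (p + q)) := by
  have hn0 : (0 : ℝ) < n := by exact_mod_cast hn
  set N := sqNorm (X *ᵥ u) / n with hN
  have hNpos : 0 < N := by positivity
  set F := (∑ i, sqNorm (X i)) / n with hF
  have hF0 : 0 ≤ F := div_nonneg (Finset.sum_nonneg fun i _ => sqNorm_nonneg _) hn0.le
  have hbound : ∀ w : Fin p → ℝ, sqNorm (X *ᵥ w) / n ≤ F * sqNorm w := fun w => by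
    rw [hF, div_mul_eq_mul_div]
    exact div_le_div_of_nonneg_right (sqNorm_mulVec_le X w) hn0.le
  have hNF : N ≤ F := by simpa [hu] using hbound u
  -- A radius this small keeps the ball inside the shell (r ≤ 1/2) and makes F r² ≤ N, so the form
  -- is at most 4N on the ball. The ball's volume is of order (N/(1 + F))ᵖ; this is why the exponent
  -- rises from q to p + q and a factor (1 + F)ᵖ appears.
  set r := N / (2 * (1 + F)) with hr
  have hr0 : 0 < r := by positivity
  have hr1 : r ≤ 1 / 2 := by
    rw [hr, div_le_div_iff₀ (by positivity) (by norm_num)]; linarith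
  have hFr : F * r ^ 2 ≤ N := by
    have h1 : r * (2 * (1 + F)) = N := by rw [hr]; field_simp
    nlinarith
  set u' : EuclideanSpace ℝ (Fin p) := WithLp.toLp 2 u with hu'
  have hu'n : ‖u'‖ = 1 := by
    have : ‖u'‖ ^ 2 = 1 := by rw [← sqNorm_ofLp, hu', hu]
    nlinarith [norm_nonneg u']
  have hsub : Metric.ball u' r ⊆ shell p := by
    intro v hv
    rw [mem_ball_iff_norm] at hv
    have h1 : ‖u'‖ ≤ ‖v‖ + ‖v - u'‖ := by
      have := norm_sub_le v (v - u')
      simpa using this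
    have h2 : ‖v‖ ≤ ‖u'‖ + ‖v - u'‖ := by
      have := norm_add_le u' (v - u')
      simpa using this
    constructor <;> linarith
  have hsmall : ∀ v ∈ Metric.ball u' r, sqNorm (X *ᵥ v.ofLp) / n ≤ 4 * N := by
    intro v hv
    rw [mem_ball_iff_norm] at hv
    have h1 : X *ᵥ v.ofLp = X *ᵥ u + X *ᵥ (v - u').ofLp := by
      rw [← mulVec_add]; congr 1; simp [hu']
    have h2 := sqNorm_add_le (X *ᵥ u) (X *ᵥ (v - u').ofLp)
    have h3 := hbound (v - u').ofLp
    rw [sqNorm_ofLp (v - u')] at h3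
    have h4 : F * ‖v - u'‖ ^ 2 ≤ F * r ^ 2 := by gcongr
    rw [h1]
    calc _ ≤ 2 * (sqNorm (X *ᵥ u) + sqNorm (X *ᵥ (v - u').ofLp)) / n := by gcongr
      _ = 2 * (N + sqNorm (X *ᵥ (v - u').ofLp) / n) := by rw [hN]; ring
      _ ≤ 4 * N := by linarith
  set ω := volume (Metric.ball (0 : EuclideanSpace ℝ (Fin p)) 1) with hω
  have hω0 : ω ≠ 0 := (Metric.measure_ball_pos _ _ one_pos).ne'
  have hωt : ω ≠ ∞ := measure_ball_lt_top.ne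
  have hvol : volume (Metric.ball u' r) = ENNReal.ofReal (r ^ p) * ω := by
    rw [Measure.addHaar_ball_of_pos _ _ hr0, finrank_euclideanSpace_fin]
  have hint : (ENNReal.ofReal (4 * N))⁻¹ ^ (p + q) * (ENNReal.ofReal (r ^ p) * ω) ≤
      ∫⁻ v in shell p, (ENNReal.ofReal (sqNorm (X *ᵥ v.ofLp) / n))⁻¹ ^ (p + q) := by
    rw [← hvol, ← setLIntegral_const]
    refine le_trans (setLIntegral_mono' measurableSet_ball fun v hv => ?_)
      (lintegral_mono_set hsub)
    exact pow_le_pow_left' (ENNReal.inv_le_inv.2 (ENNReal.ofReal_le_ofReal (hsmall v hv))) _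
  refine le_trans (le_of_eq ?_) (mul_le_mul_right (mul_le_mul_right hint _) _)
  have hNi : (ENNReal.ofReal N)⁻¹ ^ q = ENNReal.ofReal (N⁻¹ ^ q) := by
    rw [← ENNReal.ofReal_inv_of_pos hNpos, ENNReal.ofReal_pow (by positivity)]
  have h4Ni : (ENNReal.ofReal (4 * N))⁻¹ ^ (p + q) = ENNReal.ofReal ((4 * N)⁻¹ ^ (p + q)) := by
    rw [← ENNReal.ofReal_inv_of_pos (by positivity), ENNReal.ofReal_pow (by positivity)]
  rw [hNi, h4Ni]
  calc ENNReal.ofReal (N⁻¹ ^ q)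
      = ENNReal.ofReal ((4 ^ (p + q) * 2 ^ p) * ((1 + F) ^ p * ((4 * N)⁻¹ ^ (p + q) * r ^ p))) := by
        congr 1
        rw [hr, div_pow, mul_pow, inv_pow, inv_pow, mul_pow, pow_add N]
        have h1 : (1 + F) ^ p ≠ 0 := by positivity
        have h2 : N ^ p ≠ 0 := by positivity
        have h3 : N ^ q ≠ 0 := by positivity
        field_simp
    _ = ENNReal.ofReal (4 ^ (p + q) * 2 ^ p) * (ENNReal.ofReal ((1 + F) ^ p) *
          (ENNReal.ofReal ((4 * N)⁻¹ ^ (p + q)) * ENNReal.ofReal (r ^ p))) := by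
        rw [← ENNReal.ofReal_mul (by positivity), ← ENNReal.ofReal_mul (by positivity),
          ← ENNReal.ofReal_mul (by positivity)]
    _ = ENNReal.ofReal (4 ^ (p + q) * 2 ^ p) * (ENNReal.ofReal ((1 + F) ^ p) *
          (ENNReal.ofReal ((4 * N)⁻¹ ^ (p + q)) * ENNReal.ofReal (r ^ p))) * (ω⁻¹ * ω) := by
        rw [ENNReal.inv_mul_cancel hω0 hωt, mul_one]
    _ = _ := by ring

/-- A functional of the design that controls its inverse moment matrix. -/
noncomputable def inverseEnvelope (q : ℕ) (X : Matrix (Fin n) (Fin p) ℝ) : ℝ≥0∞ :=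
  ENNReal.ofReal (4 ^ (p + q) * 2 ^ p) *
    (volume (Metric.ball (0 : EuclideanSpace ℝ (Fin p)) 1))⁻¹ *
    ∫⁻ v in shell p, (ENNReal.ofReal ((1 + (∑ i, sqNorm (X i)) / n) ^ (2 * (p + 1))) +
      (ENNReal.ofReal (sqNorm (X *ᵥ v.ofLp) / n))⁻¹ ^ (2 * (p + q)))

/-- The product of the trace factor and the inverse form is replaced by the sum of their squares, so
no joint moment has to be estimated later. -/
theorem inv_pow_le_inverseEnvelope (q : ℕ) (hn : 0 < n) (X : Matrix (Fin n) (Fin p) ℝ)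
    {u : Fin p → ℝ} (hu : sqNorm u = 1) (hXu : 0 < sqNorm (X *ᵥ u)) :
    (ENNReal.ofReal (sqNorm (X *ᵥ u) / n))⁻¹ ^ q ≤ inverseEnvelope q X := by
  refine (inv_pow_le_mul_lintegral_shell q hn X hu hXu).trans ?_
  rw [inverseEnvelope]
  refine mul_le_mul_right ?_ _
  rw [← lintegral_const_mul' _ _ ENNReal.ofReal_ne_top]
  refine lintegral_mono fun v => ?_
  have hF0 : 0 ≤ (∑ i, sqNorm (X i)) / (n : ℝ) :=
    div_nonneg (Finset.sum_nonneg fun i _ => sqNorm_nonneg _) (by positivity)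
  -- The exponent is raised from p to p + 1 so that it stays nonzero for p = 0, as the bound on
  -- positive moments requires.
  have h1 : ENNReal.ofReal ((1 + (∑ i, sqNorm (X i)) / n) ^ p) ≤
      ENNReal.ofReal ((1 + (∑ i, sqNorm (X i)) / n) ^ (p + 1)) :=
    ENNReal.ofReal_le_ofReal (pow_le_pow_right₀ (by linarith) (by omega))
  have h2 : ENNReal.ofReal ((1 + (∑ i, sqNorm (X i)) / n) ^ (2 * (p + 1))) =
      ENNReal.ofReal ((1 + (∑ i, sqNorm (X i)) / n) ^ (p + 1)) ^ 2 := by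
    rw [← ENNReal.ofReal_pow (by positivity), ← pow_mul, mul_comm 2]
  simp only
  rw [h2, mul_comm 2, pow_mul]
  refine (mul_le_mul_left h1 _).trans ?_
  generalize ENNReal.ofReal ((1 + (∑ i, sqNorm (X i)) / n) ^ (p + 1)) = a
  generalize (ENNReal.ofReal (sqNorm (X *ᵥ v.ofLp) / n))⁻¹ ^ (p + q) = b
  rcases le_total a b with h | h
  · calc a * b ≤ b * b := mul_le_mul_left h b
      _ ≤ _ := by rw [sq b]; exact le_add_self
  · calc a * b ≤ a * a := mul_le_mul_right h a
      _ ≤ _ := by rw [sq a]; exact le_self_add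

/-- By homogeneity it suffices to treat unit vectors, where the envelope bounds the q-th power of
the inverse form; l is the q-th root of 1 plus the envelope. -/
theorem coercive_of_inverseEnvelope_lt {q : ℕ} {X : Matrix (Fin n) (Fin p) ℝ}
    (hX : IsUnit (Xᵀ * X).det) (hn : (0 : ℝ) < n) (hQ : inverseEnvelope q X ≠ ∞) {l : ℝ}
    (hl : 0 < l) (hlq : l ^ q = 1 + (inverseEnvelope q X).toReal) (v : Fin p → ℝ) :
    n / l * sqNorm v ≤ sqNorm (X *ᵥ v) := by
  rcases eq_or_ne v 0 with rfl | hv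
  · simp
  have hpos : 0 < sqNorm v := lt_of_le_of_ne (sqNorm_nonneg v) fun h => hv (sqNorm_eq_zero.1 h.symm)
  set c := (√(sqNorm v))⁻¹ with hc
  have hc2 : c ^ 2 = (sqNorm v)⁻¹ := by rw [hc, inv_pow, Real.sq_sqrt hpos.le]
  have hu : sqNorm (c • v) = 1 := by rw [sqNorm_smul, hc2, inv_mul_cancel₀ hpos.ne']
  have hXv : 0 < sqNorm (X *ᵥ v) := by
    refine lt_of_le_of_ne (sqNorm_nonneg _) fun h => hv ?_
    have h0 := sqNorm_eq_zero.1 h.symm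
    have h1 : (Xᵀ * X) *ᵥ v = 0 := by rw [← mulVec_mulVec, h0, mulVec_zero]
    have h2 := congrArg ((Xᵀ * X)⁻¹ *ᵥ ·) h1
    simpa [mulVec_mulVec, Matrix.nonsing_inv_mul _ hX] using h2
  have hXu : sqNorm (X *ᵥ (c • v)) = sqNorm (X *ᵥ v) / sqNorm v := by
    rw [mulVec_smul, sqNorm_smul, hc2, inv_mul_eq_div]
  have hXu0 : 0 < sqNorm (X *ᵥ (c • v)) := by rw [hXu]; positivity
  have h1 := inv_pow_le_inverseEnvelope q (by exact_mod_cast hn) X hu hXu0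
  set N := sqNorm (X *ᵥ (c • v)) / n with hN
  have hN0 : 0 < N := by positivity
  rw [← ENNReal.ofReal_inv_of_pos hN0, ← ENNReal.ofReal_pow (by positivity),
    ENNReal.ofReal_le_iff_le_toReal hQ] at h1
  have h2 : N⁻¹ ^ q ≤ l ^ q := by linarith
  -- For q = 0 the hypotheses contradict each other: the envelope would be at least 1 and equal to
  -- 0.
  have h3 : N⁻¹ ≤ l := by
    rcases Nat.eq_zero_or_pos q with hq | hq
    · subst hq
      simp only [pow_zero] at h1 hlq
      linarith
    · exact (pow_le_pow_iff_left₀ (by positivity) hl.le hq.ne').1 h2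
  rw [inv_le_iff_one_le_mul₀ hN0, hN, hXu] at h3
  rw [div_mul_eq_mul_div, div_le_iff₀ hl]
  have h4 : l * (sqNorm (X *ᵥ v) / sqNorm v / n) = l * sqNorm (X *ᵥ v) / (sqNorm v * n) := by
    field_simp
  rw [h4, le_div_iff₀ (by positivity)] at h3
  linarith

end NegativeMoments

/-! ### Uniform moment bounds for the observational sample -/

namespace LinearGaussianSEM

variable {p d : ℕ} (M : LinearGaussianSEM p d)

theorem sFinite_pi_obsLaw (n : ℕ) : SFinite (Measure.pi fun _ : Fin n => M.obsLaw) := by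
  have h : IsProbabilityMeasure (Measure.pi fun _ : Fin n => M.obsLaw) := inferInstance
  generalize (Measure.pi fun _ : Fin n => M.obsLaw) = μ at h
  infer_instance

theorem lintegral_even_pow_dotProduct_obsLaw_lt_top (v : Fin p → ℝ) (q : ℕ) :
    ∫⁻ s, ENNReal.ofReal ((s.1 ⬝ᵥ v) ^ (2 * q)) ∂M.obsLaw < ∞ := by
  have h := lintegral_even_pow_gaussianReal_lt_top
    (v ⬝ᵥ (M.covX + M.B * M.covZ * M.Bᵀ) *ᵥ v).toNNReal q
  rwa [← M.map_dotProduct_obsLaw v, lintegral_map (by fun_prop)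
    (by exact (measurable_dotProduct_const v).comp measurable_fst)] at h

theorem lintegral_even_pow_snd_obsLaw_lt_top (q : ℕ) :
    ∫⁻ s, ENNReal.ofReal (s.2 ^ (2 * q)) ∂M.obsLaw < ∞ := by
  obtain ⟨a, ha⟩ := M.exists_map_snd_obsLaw
  have h := lintegral_even_pow_gaussianReal_lt_top a q
  rwa [← ha, lintegral_map (by fun_prop) measurable_snd] at h

theorem lintegral_one_add_sqNorm_pow_obsLaw_lt_top (q : ℕ) :
    ∫⁻ s, ENNReal.ofReal ((1 + sqNorm s.1) ^ q) ∂M.obsLaw < ∞ := by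
  have hpt : ∀ x : Fin p → ℝ, ENNReal.ofReal ((1 + sqNorm x) ^ q) ≤
      ENNReal.ofReal ((p + 1) ^ q) * (1 + ∑ j, ENNReal.ofReal ((x ⬝ᵥ Pi.single j 1) ^ (2 * q))) := by
    intro x
    -- Power mean inequality for the p + 1 numbers 1, x₁², …, x_p².
    set z : Option (Fin p) → ℝ := fun o => o.elim 1 fun j => x j ^ 2 with hz
    have hz0 : ∀ o, 0 ≤ z o := by
      rintro (_ | j) <;> simp [hz, sq_nonneg]
    have hcard : (0 : ℝ) < p + 1 := by positivity
    have h1 := Real.pow_arith_mean_le_arith_mean_pow Finset.univ (fun _ => (p + 1 : ℝ)⁻¹) z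
      (fun _ _ => by positivity) (by simp [hcard.ne']) (fun o _ => hz0 o) q
    rw [← Finset.mul_sum, ← Finset.mul_sum, Fintype.sum_option, Fintype.sum_option] at h1
    simp only [hz, Option.elim, one_pow, ← pow_mul] at h1
    have hsn : ∑ j, x j ^ 2 = sqNorm x := rfl
    rw [hsn, mul_pow, inv_pow, inv_mul_le_iff₀ (by positivity)] at h1
    have h2 : 0 ≤ ∑ j, x j ^ (2 * q) :=
      Finset.sum_nonneg fun j _ => (even_two_mul q).pow_nonneg _
    simp only [dotProduct_single, mul_one]
    rw [← ENNReal.ofReal_sum_of_nonneg fun j _ => (even_two_mul q).pow_nonneg _,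
      ← ENNReal.ofReal_one, ← ENNReal.ofReal_add zero_le_one h2,
      ← ENNReal.ofReal_mul (by positivity)]
    refine ENNReal.ofReal_le_ofReal (h1.trans ?_)
    refine mul_le_mul_of_nonneg_left ?_ (by positivity)
    exact mul_le_of_le_one_left (by linarith) (inv_le_one_of_one_le₀ (by
      have : (0 : ℝ) ≤ p := by positivity
      linarith))
  have hm : ∀ j, Measurable fun s : (Fin p → ℝ) × ℝ =>
      ENNReal.ofReal ((s.1 ⬝ᵥ Pi.single j 1) ^ (2 * q)) := fun j =>
    (((measurable_dotProduct_const _).comp measurable_fst).pow_const _).ennreal_ofReal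
  refine lt_of_le_of_lt (lintegral_mono fun s => hpt s.1) ?_
  rw [lintegral_const_mul' _ _ ENNReal.ofReal_ne_top, lintegral_add_left measurable_const,
    lintegral_finsetSum _ fun j _ => hm j]
  refine ENNReal.mul_lt_top ENNReal.ofReal_lt_top (ENNReal.add_lt_top.2 ⟨by simp, ?_⟩)
  exact ENNReal.sum_lt_top.2 fun j _ => M.lintegral_even_pow_dotProduct_obsLaw_lt_top _ q

/-- Under a non-singular covariance, no direction of the shell carries much mass near `0`. -/
theorem exists_lintegral_inv_sqrt_dotProduct_le
    (hobs : (M.covX + M.B * M.covZ * M.Bᵀ).PosDef) :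
    ∃ C : ℝ≥0∞, C < ∞ ∧ ∀ v ∈ shell p,
      ∫⁻ s, (ENNReal.ofReal |s.1 ⬝ᵥ v.ofLp|)⁻¹ ^ (2⁻¹ : ℝ) ∂M.obsLaw ≤ C := by
  obtain ⟨c, hc, hcoer⟩ := exists_coercive_of_pos fun v hv => by
    simpa using hobs.dotProduct_mulVec_pos hv
  refine ⟨(ENNReal.ofReal √(c / 4))⁻¹ ^ (2⁻¹ : ℝ) *
    ∫⁻ x, (ENNReal.ofReal |x|)⁻¹ ^ (2⁻¹ : ℝ) ∂(gaussianReal 0 1), ?_, fun v hv => ?_⟩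
  · refine ENNReal.mul_lt_top (ENNReal.rpow_lt_top_of_nonneg (by norm_num) ?_)
      lintegral_inv_sqrt_gaussianReal_zero_one_lt_top
    rw [ne_eq, ENNReal.inv_eq_top, ENNReal.ofReal_eq_zero, not_le]
    positivity
  · have h1 : c / 4 ≤ v.ofLp ⬝ᵥ (M.covX + M.B * M.covZ * M.Bᵀ) *ᵥ v.ofLp := by
      refine le_trans ?_ (hcoer v.ofLp)
      rw [sqNorm_ofLp]
      have hv1 : 1 / 2 ≤ ‖v‖ := hv.1
      have hv2 : 1 / 4 ≤ ‖v‖ ^ 2 := by nlinarith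
      nlinarith
    set w := v.ofLp ⬝ᵥ (M.covX + M.B * M.covZ * M.Bᵀ) *ᵥ v.ofLp
    have hw : 0 < w := by linarith
    have h2 := lintegral_inv_sqrt_gaussianReal w.toNNReal (Real.toNNReal_pos.2 hw).ne'
    rw [← M.map_dotProduct_obsLaw v.ofLp, lintegral_map (by fun_prop)
      (by exact (measurable_dotProduct_const v.ofLp).comp measurable_fst)] at h2
    rw [h2, Real.coe_toNNReal _ hw.le]
    gcongr

/-- Tonelli moves the expectation inside the integral over the shell, where each direction is fixed
and the one-dimensional negative moments apply uniformly. These use exponent 2(p + q), hence the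
sample size 4·2(p + q); the extra 1 keeps n positive. -/
theorem exists_lintegral_inverseEnvelope_le (q : ℕ)
    (hobs : (M.covX + M.B * M.covZ * M.Bᵀ).PosDef) :
    ∃ K : ℝ≥0∞, K < ∞ ∧ ∀ n : ℕ, 8 * (p + q) + 1 ≤ n →
      ∫⁻ s, inverseEnvelope q (design s) ∂(Measure.pi fun _ : Fin n => M.obsLaw) ≤ K := by
  obtain ⟨C, hC, hCv⟩ := M.exists_lintegral_inv_sqrt_dotProduct_le hobs
  set D := ∫⁻ s, ENNReal.ofReal ((1 + sqNorm s.1) ^ (2 * (p + 1))) ∂M.obsLaw with hDdef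
  have hD : D < ∞ := M.lintegral_one_add_sqNorm_pow_obsLaw_lt_top _
  set A := ENNReal.ofReal (4 ^ (p + q) * 2 ^ p) *
    (volume (Metric.ball (0 : EuclideanSpace ℝ (Fin p)) 1))⁻¹ with hA
  have hAt : A < ∞ := ENNReal.mul_lt_top ENNReal.ofReal_lt_top
    (ENNReal.inv_lt_top.2 (Metric.measure_ball_pos _ _ one_pos))
  refine ⟨A * ((D + C ^ (4 * (2 * (p + q)))) * volume (shell p)),
    ENNReal.mul_lt_top hAt (ENNReal.mul_lt_top (ENNReal.add_lt_top.2 ⟨hD, ENNReal.pow_lt_top hC⟩)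
      (volume_shell_lt_top p)), fun n hn => ?_⟩
  have hn0 : (0 : ℝ) < n := by exact_mod_cast (by omega : 0 < n)
  simp only [inverseEnvelope]
  rw [lintegral_const_mul' _ _ hAt.ne]
  refine mul_le_mul_right ?_ _
  have hdes : ∀ i : Fin n, Measurable fun s : Fin n → (Fin p → ℝ) × ℝ => sqNorm (design s i) := by
    intro i
    simp only [sqNorm, design, of_apply]
    fun_prop
  have hm1 : Measurable fun s : Fin n → (Fin p → ℝ) × ℝ =>
      ENNReal.ofReal ((1 + (∑ i, sqNorm (design s i)) / n) ^ (2 * (p + 1))) := by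
    fun_prop
  have hm2 : Measurable fun w : (Fin n → (Fin p → ℝ) × ℝ) × EuclideanSpace ℝ (Fin p) =>
      (ENNReal.ofReal (sqNorm (design w.1 *ᵥ w.2.ofLp) / n))⁻¹ ^ (2 * (p + q)) := by
    simp only [sqNorm, mulVec, dotProduct, design, of_apply]
    fun_prop
  have hmm : Measurable fun w : (Fin n → (Fin p → ℝ) × ℝ) × EuclideanSpace ℝ (Fin p) =>
      ENNReal.ofReal ((1 + (∑ i, sqNorm (design w.1 i)) / n) ^ (2 * (p + 1))) +
      (ENNReal.ofReal (sqNorm (design w.1 *ᵥ w.2.ofLp) / n))⁻¹ ^ (2 * (p + q)) :=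
    (hm1.comp measurable_fst).add hm2
  have := M.sFinite_pi_obsLaw n
  rw [lintegral_lintegral_swap hmm.aemeasurable, ← setLIntegral_const]
  refine setLIntegral_mono' (measurableSet_shell p) fun v hv => ?_
  rw [lintegral_add_left hm1]
  refine add_le_add ?_ ?_
  -- Writing 1 + ‖x‖² as the square of its root casts the trace term as a mean of squares.
  · have hf : Measurable fun s : (Fin p → ℝ) × ℝ => √(1 + sqNorm s.1) := by
      unfold sqNorm; fun_prop
    have h1 := lintegral_mean_sq_pow_le M.obsLaw hf (Finset.univ : Finset (Fin n))
      (q := 2 * (p + 1)) (by omega)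
    have hsq : ∀ x : Fin p → ℝ, √(1 + sqNorm x) ^ 2 = 1 + sqNorm x := fun x =>
      Real.sq_sqrt (by linarith [sqNorm_nonneg x])
    simp only [hsq, pow_mul √_, Finset.sum_add_distrib, Finset.card_univ, Fintype.card_fin] at h1
    simp only [Finset.sum_const, Finset.card_univ, Fintype.card_fin, nsmul_eq_mul, mul_one,
      add_div, div_self hn0.ne'] at h1
    exact h1
  · have hf : Measurable fun s : (Fin p → ℝ) × ℝ => s.1 ⬝ᵥ v.ofLp :=
      (measurable_dotProduct_const v.ofLp).comp measurable_fst
    have h1 := lintegral_inv_mean_sq_pow_le M.obsLaw hf (Finset.univ : Finset (Fin n))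
      (2 * (p + q)) (Finset.card_pos.1 (by simp; omega)) (by simp; omega)
    simp only [Finset.card_univ, Fintype.card_fin] at h1
    exact h1.trans (pow_le_pow_left' (hCv v hv) _)

/-- The observational part of the data enters the error bound only through a quantity with
bounded third moment. -/
theorem exists_observational_envelope (hobs : (M.covX + M.B * M.covZ * M.Bᵀ).PosDef) :
    ∃ K : ℝ≥0∞, K < ∞ ∧ ∀ n : ℕ, 8 * (p + 6) + 1 ≤ n →
      ∃ Θ : (Fin n → (Fin p → ℝ) × ℝ) → ℝ≥0∞,
        ∫⁻ s, Θ s ∂(Measure.pi fun _ : Fin n => M.obsLaw) ≤ K ∧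
        ∀ s, Θ s ≠ ∞ → ∃ θ : ℝ, 1 ≤ θ ∧ sqNorm (M.α - ols (design s) (outcomes s)) ≤ θ ∧
          (∀ v, sqNorm (covHat (design s) (outcomes s) *ᵥ v) ≤ θ ^ 2 * sqNorm v) ∧
          ENNReal.ofReal (θ ^ 3) ≤ Θ s := by
  -- The envelope θ is c + 2yl with y the mean square outcome and n/l a lower bound for the Gram
  -- matrix. Its third power involves (yl)³ ≤ (y⁶ + l⁶)/2, so sixth moments of both suffice and no
  -- independence of X and Y is used.
  obtain ⟨K, hK, hKn⟩ := M.exists_lintegral_inverseEnvelope_le 6 hobs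
  set D := ∫⁻ s, ENNReal.ofReal (s.2 ^ (2 * 6)) ∂M.obsLaw
  have hD : D < ∞ := M.lintegral_even_pow_snd_obsLaw_lt_top 6
  set c := 1 + 2 * sqNorm M.α with hc
  have hα := sqNorm_nonneg M.α
  have hc1 : 1 ≤ c := by linarith
  refine ⟨ENNReal.ofReal (32 * c ^ 3) * (2 + D + K), ENNReal.mul_lt_top ENNReal.ofReal_lt_top
    (ENNReal.add_lt_top.2 ⟨ENNReal.add_lt_top.2 ⟨by simp, hD⟩, hK⟩), fun n hn => ?_⟩
  have hn0 : (0 : ℝ) < n := by exact_mod_cast (by omega : 0 < n)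
  have hn1 : (1 : ℝ) ≤ n := by exact_mod_cast (by omega : 1 ≤ n)
  refine ⟨fun s => ENNReal.ofReal (32 * c ^ 3) *
    (2 + ENNReal.ofReal ((sqNorm (outcomes s) / n) ^ 6) + inverseEnvelope 6 (design s)), ?_, ?_⟩
  · have hm : Measurable fun s : Fin n → (Fin p → ℝ) × ℝ =>
        2 + ENNReal.ofReal ((sqNorm (outcomes s) / n) ^ 6) := by
      simp only [sqNorm, outcomes]; fun_prop
    rw [lintegral_const_mul' _ _ ENNReal.ofReal_ne_top, lintegral_add_left hm,
      lintegral_add_left measurable_const]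
    have hy := lintegral_mean_sq_pow_le M.obsLaw (measurable_snd)
      (Finset.univ : Finset (Fin n)) (q := 6) (by norm_num)
    simp only [Finset.card_univ, Fintype.card_fin] at hy
    gcongr
    · simp
    · exact hy
    · exact hKn n hn
  · intro s hs
    set X := design s with hXdef
    set Y := outcomes s with hYdef
    set y := sqNorm Y / n with hy
    have hy0 : 0 ≤ y := div_nonneg (sqNorm_nonneg _) hn0.le
    have hc3 : ENNReal.ofReal (32 * c ^ 3) ≠ 0 := by
      rw [ne_eq, ENNReal.ofReal_eq_zero, not_le]; positivity
    have hQ : inverseEnvelope 6 X ≠ ∞ := by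
      intro h
      apply hs
      change ENNReal.ofReal _ * (_ + inverseEnvelope 6 X) = ∞
      rw [h, add_top, ENNReal.mul_top hc3]
    set Q := (inverseEnvelope 6 X).toReal with hQdef
    have hQ0 : 0 ≤ Q := ENNReal.toReal_nonneg
    have hΘ : ENNReal.ofReal (32 * c ^ 3) * (2 + ENNReal.ofReal (y ^ 6) + inverseEnvelope 6 X) =
        ENNReal.ofReal (32 * c ^ 3 * (2 + y ^ 6 + Q)) := by
      rw [ENNReal.ofReal_mul (p := 32 * c ^ 3) (by positivity),
        ENNReal.ofReal_add (by positivity) hQ0, ENNReal.ofReal_add (by positivity) (by positivity), hQdef, ENNReal.ofReal_toReal hQ]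
      simp
    change ∃ θ : ℝ, _ ∧ _ ∧ _ ∧ ENNReal.ofReal (θ ^ 3) ≤
      ENNReal.ofReal (32 * c ^ 3) * (2 + ENNReal.ofReal (y ^ 6) + inverseEnvelope 6 X)
    rw [hΘ]
    obtain ⟨l, hl0, hl6⟩ : ∃ l : ℝ, 0 < l ∧ l ^ 6 = 1 + Q :=
      ⟨(1 + Q) ^ ((6 : ℕ) : ℝ)⁻¹, by positivity, Real.rpow_inv_natCast_pow (by positivity) (by norm_num)⟩
    have hθ3 : (c + 2 * (y * l)) ^ 3 ≤ 32 * c ^ 3 * (2 + y ^ 6 + Q) := by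
      have hyl : 0 ≤ y * l := by positivity
      have h1 : c + 2 * (y * l) ≤ c * (1 + 2 * (y * l)) := by nlinarith
      have h2 : (1 + 2 * (y * l)) ^ 3 ≤ 4 * (1 + 8 * (y * l) ^ 3) := by
        have := add_pow_le (a := 1) (b := 2 * (y * l)) (by positivity) (by positivity) 3
        rw [mul_pow 2] at this
        norm_num at this
        linarith
      have h3 : 2 * (y * l) ^ 3 ≤ y ^ 6 + l ^ 6 := by
        nlinarith [sq_nonneg (y ^ 3 - l ^ 3)]
      calc (c + 2 * (y * l)) ^ 3 ≤ (c * (1 + 2 * (y * l))) ^ 3 := by gcongr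
        _ = c ^ 3 * (1 + 2 * (y * l)) ^ 3 := by rw [mul_pow]
        _ ≤ c ^ 3 * (4 * (1 + 8 * (y * l) ^ 3)) := by gcongr
        _ ≤ c ^ 3 * (32 * (2 + y ^ 6 + Q)) := by
            refine mul_le_mul_of_nonneg_left ?_ (by positivity)
            have : 0 ≤ y ^ 6 := by positivity
            linarith
        _ = _ := by ring
    refine ⟨c + 2 * (y * l), by nlinarith [mul_nonneg hy0 hl0.le], ?_, ?_,
      ENNReal.ofReal_le_ofReal hθ3⟩
    all_goals
      have hyl : 0 ≤ y * l := by positivity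
    · by_cases hX : IsUnit (Xᵀ * X).det
      swap
      · rw [ols, Matrix.nonsing_inv_apply_not_isUnit _ hX, zero_mulVec, sub_zero]
        linarith
      have hcond := coercive_of_inverseEnvelope_lt hX hn0 hQ hl0 hl6
      have h1 := mul_sqNorm_ols_le hX hcond Y
      have h2 : sqNorm (ols X Y) ≤ y * l := by
        rw [div_mul_eq_mul_div, div_le_iff₀ hl0] at h1
        rw [hy, div_mul_eq_mul_div, le_div_iff₀ hn0]
        linarith
      have h3 := sqNorm_add_le M.α (-ols X Y)
      rw [← sub_eq_add_neg, sqNorm_neg] at h3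
      linarith
    · intro v
      by_cases hX : IsUnit (Xᵀ * X).det
      swap
      · rw [covHat, Matrix.nonsing_inv_apply_not_isUnit _ hX, smul_zero, zero_mulVec, sqNorm_zero]
        exact mul_nonneg (sq_nonneg _) (sqNorm_nonneg v)
      have hcond := coercive_of_inverseEnvelope_lt hX hn0 hQ hl0 hl6
      have h1 := sq_mul_sqNorm_covHat_mulVec_le hX (by positivity) hcond Y v
      have h2 := pow_le_pow_left₀ (varHat_nonneg X Y) (varHat_le hX (by omega) Y) 2
      have hv := sqNorm_nonneg v
      have hCv := sqNorm_nonneg (covHat X Y *ᵥ v)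
      -- The covariance estimate is of order 1/n, but only its boundedness matters, so n ≥ 1
      -- discards that factor.
      have h3 : (1 / l) ^ 2 * sqNorm (covHat X Y *ᵥ v) ≤ (2 * y) ^ 2 * sqNorm v := by
        calc (1 / l) ^ 2 * sqNorm (covHat X Y *ᵥ v)
            ≤ (n / l) ^ 2 * sqNorm (covHat X Y *ᵥ v) := by gcongr
          _ ≤ varHat X Y ^ 2 * sqNorm v := h1
          _ ≤ _ := by gcongr
      rw [one_div, inv_pow, inv_mul_le_iff₀ (by positivity)] at h3
      calc sqNorm (covHat X Y *ᵥ v) ≤ l ^ 2 * ((2 * y) ^ 2 * sqNorm v) := h3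
        _ = (2 * (y * l)) ^ 2 * sqNorm v := by ring
        _ ≤ _ := by gcongr; linarith

end LinearGaussianSEM

/-! ### Well-conditioned interventional designs with high probability -/

section WeakLaw

variable {p : ℕ}

/-- The entries of `x xᵀ / (1 + ‖x‖²)`. -/
noncomputable def truncMoment (j k : Fin p) (x : Fin p → ℝ) : ℝ := x j * x k / (1 + sqNorm x)

theorem measurable_truncMoment (j k : Fin p) : Measurable (truncMoment j k) := by
  unfold truncMoment sqNorm
  fun_prop

theorem abs_truncMoment_le_one (j k : Fin p) (x : Fin p → ℝ) : |truncMoment j k x| ≤ 1 := by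
  have h : ∀ i, x i ^ 2 ≤ sqNorm x := fun i =>
    Finset.single_le_sum (f := fun i => x i ^ 2) (fun _ _ => sq_nonneg _) (Finset.mem_univ i)
  have h0 := sqNorm_nonneg x
  rw [truncMoment, abs_div, abs_of_pos (by linarith : 0 < 1 + sqNorm x),
    div_le_one (by linarith), abs_le]
  constructor <;> nlinarith [h j, h k, sq_nonneg (x j - x k), sq_nonneg (x j + x k)]

theorem sum_sum_truncMoment (v x : Fin p → ℝ) :
    ∑ j, ∑ k, v j * v k * truncMoment j k x = (v ⬝ᵥ x) ^ 2 / (1 + sqNorm x) := by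
  simp only [truncMoment, dotProduct, sq, Finset.sum_mul_sum, Finset.sum_div]
  refine Finset.sum_congr rfl fun j _ => Finset.sum_congr rfl fun k _ => ?_
  ring

theorem memLp_truncMoment (ν : Measure (Fin p → ℝ)) [IsFiniteMeasure ν] (j k : Fin p)
    (q : ℝ≥0∞) : MemLp (truncMoment j k) q ν :=
  MemLp.of_bound (measurable_truncMoment j k).aestronglyMeasurable 1
    (ae_of_all _ fun x => abs_truncMoment_le_one j k x)

/-- The quadratic form is E[(v·x)²/(1 + ‖x‖²)], which vanishes only if v·x = 0 almost surely. The
truncation makes it finite without any moment assumption. -/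
theorem exists_truncMoment_coercive (ν : Measure (Fin p → ℝ)) [IsProbabilityMeasure ν]
    (hν : ∀ v : Fin p → ℝ, v ≠ 0 → ¬ ∀ᵐ x ∂ν, v ⬝ᵥ x = 0) :
    ∃ c : ℝ, 0 < c ∧ ∀ v : Fin p → ℝ,
      c * sqNorm v ≤ ∑ j, ∑ k, v j * v k * ∫ x, truncMoment j k x ∂ν := by
  have hint : ∀ j k, Integrable (truncMoment j k) ν := fun j k =>
    memLp_one_iff_integrable.1 (memLp_truncMoment ν j k 1)
  have hform : ∀ v : Fin p → ℝ, ∑ j, ∑ k, v j * v k * ∫ x, truncMoment j k x ∂ν =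
      ∫ x, (v ⬝ᵥ x) ^ 2 / (1 + sqNorm x) ∂ν := by
    intro v
    simp only [← sum_sum_truncMoment]
    rw [integral_finsetSum _ fun j _ => integrable_finsetSum _ fun k _ => (hint j k).const_mul _]
    refine Finset.sum_congr rfl fun j _ => ?_
    rw [integral_finsetSum _ fun k _ => (hint j k).const_mul _]
    exact Finset.sum_congr rfl fun k _ => (integral_const_mul _ _).symm
  have hmat : ∀ v : Fin p → ℝ, ∑ j, ∑ k, v j * v k * ∫ x, truncMoment j k x ∂ν =
      v ⬝ᵥ ((Matrix.of fun j k => ∫ x, truncMoment j k x ∂ν) *ᵥ v) := by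
    intro v
    simp only [dotProduct, mulVec, of_apply, Finset.mul_sum]
    refine Finset.sum_congr rfl fun j _ => Finset.sum_congr rfl fun k _ => ?_
    ring
  simp only [hmat]
  refine exists_coercive_of_pos fun v hv => ?_
  rw [← hmat, hform]
  have hnn : ∀ x, 0 ≤ (v ⬝ᵥ x) ^ 2 / (1 + sqNorm x) := fun x =>
    div_nonneg (sq_nonneg _) (by linarith [sqNorm_nonneg x])
  refine lt_of_le_of_ne (integral_nonneg hnn) fun h0 => hν v hv ?_
  have hi : Integrable (fun x => (v ⬝ᵥ x) ^ 2 / (1 + sqNorm x)) ν := by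
    simp only [← sum_sum_truncMoment]
    exact integrable_finsetSum _ fun j _ => integrable_finsetSum _ fun k _ => (hint j k).const_mul _
  filter_upwards [(integral_eq_zero_iff_of_nonneg hnn hi).1 h0.symm] with x hx
  have hx1 : (v ⬝ᵥ x) ^ 2 / (1 + sqNorm x) = 0 := hx
  have hpos : (1 + sqNorm x) ≠ 0 := by linarith [sqNorm_nonneg x]
  simpa [hpos] using hx1

/-- Chebyshev's inequality: the summands are bounded by 1, so the variance of the sum is at most m.
-/
theorem measure_truncMoment_deviation_le (ν : Measure (Fin p → ℝ)) [IsProbabilityMeasure ν]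
    (j k : Fin p) {δ : ℝ} (hδ : 0 < δ) {m : ℕ} (hm : 0 < m) :
    (Measure.pi fun _ : Fin m => ν) {x | δ * m ≤ |∑ i, truncMoment j k (x i) -
      m * ∫ y, truncMoment j k y ∂ν|} ≤ ENNReal.ofReal ((δ ^ 2)⁻¹ / m) := by
  have hm0 : (0 : ℝ) < m := by exact_mod_cast hm
  set μ := Measure.pi fun _ : Fin m => ν
  have hL : MemLp (truncMoment j k) 2 ν := memLp_truncMoment ν j k 2
  have heq : (∑ i, fun x : Fin m → Fin p → ℝ => truncMoment j k (x i)) =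
      fun x => ∑ i, truncMoment j k (x i) := by ext x; simp
  have hLi : ∀ i : Fin m, MemLp (fun x : Fin m → Fin p → ℝ => truncMoment j k (x i)) 2 μ :=
    fun i => hL.comp_measurePreserving (measurePreserving_eval (fun _ : Fin m => ν) i)
  have hvar : Var[fun x : Fin m → Fin p → ℝ => ∑ i, truncMoment j k (x i); μ] ≤ m := by
    have h1 := variance_sum_pi (μ := fun _ : Fin m => ν) (X := fun _ => truncMoment j k)
      fun _ => hL
    rw [heq] at h1
    rw [h1]
    have h2 : Var[truncMoment j k; ν] ≤ 1 := by
      refine (variance_le_expectation_sq (hL.aestronglyMeasurable)).trans ?_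
      calc ∫ x, (truncMoment j k ^ 2) x ∂ν ≤ ∫ _, (1 : ℝ) ∂ν := by
            refine integral_mono_of_nonneg (ae_of_all _ fun x => sq_nonneg _)
              (integrable_const _) (ae_of_all _ fun x => ?_)
            have := abs_truncMoment_le_one j k x
            rw [Pi.pow_apply]
            exact (sq_le_one_iff_abs_le_one _).2 this
        _ = 1 := by simp
    calc ∑ _ : Fin m, Var[truncMoment j k; ν] ≤ ∑ _ : Fin m, (1 : ℝ) :=
          Finset.sum_le_sum fun _ _ => h2
      _ = m := by simp
  have hmean : ∫ x, ∑ i, truncMoment j k (x i) ∂μ = m * ∫ y, truncMoment j k y ∂ν := by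
    rw [integral_finsetSum _ fun i _ => (hLi i).integrable one_le_two]
    have : ∀ i : Fin m, ∫ x, truncMoment j k (x i) ∂μ = ∫ y, truncMoment j k y ∂ν := fun i =>
      integral_comp_eval (μ := fun _ : Fin m => ν) (i := i) hL.aestronglyMeasurable
    simp [this]
  have hcheb := meas_ge_le_variance_div_sq (μ := μ)
    (X := fun x : Fin m → Fin p → ℝ => ∑ i, truncMoment j k (x i))
    (heq ▸ memLp_finsetSum' _ fun i _ => hLi i) (c := δ * m) (by positivity)
  rw [hmean] at hcheb
  refine hcheb.trans (ENNReal.ofReal_le_ofReal ?_)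
  rw [div_le_iff₀ (by positivity)]
  refine hvar.trans (le_of_eq ?_)
  field_simp

/-- With probability `1 - O(1/m)` the moment matrix of `m` observations is at least of order `m`. -/
theorem exists_coercive_gram (ν : Measure (Fin p → ℝ)) [IsProbabilityMeasure ν]
    (hν : ∀ v : Fin p → ℝ, v ≠ 0 → ¬ ∀ᵐ x ∂ν, v ⬝ᵥ x = 0) :
    ∃ κ : ℝ, 0 < κ ∧ ∃ C : ℝ, 0 < C ∧ ∀ m : ℕ, 0 < m → ∃ B : Set (Fin m → Fin p → ℝ),
      MeasurableSet B ∧ (Measure.pi fun _ : Fin m => ν) B ≤ ENNReal.ofReal (C / m) ∧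
      ∀ x ∉ B, ∀ v, κ * m * sqNorm v ≤ sqNorm (Matrix.of x *ᵥ v) := by
  obtain ⟨c, hc, hcoer⟩ := exists_truncMoment_coercive ν hν
  -- Entrywise deviations below δm change the form by at most pδm‖v‖² ≤ (c/2)m‖v‖², leaving half of
  -- the coercivity. The p + 1 here and the p·p + 1 below avoid degenerate constants when p = 0.
  set δ := c / (2 * (p + 1)) with hδ
  have hδ0 : 0 < δ := by positivity
  refine ⟨c / 2, by positivity, (p * p + 1) * (δ ^ 2)⁻¹, by positivity, fun m hm => ?_⟩
  have hm0 : (0 : ℝ) < m := by exact_mod_cast hm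
  set D : Fin p → Fin p → Set (Fin m → Fin p → ℝ) := fun j k =>
    {x | δ * m ≤ |∑ i, truncMoment j k (x i) - m * ∫ y, truncMoment j k y ∂ν|} with hD
  refine ⟨⋃ j, ⋃ k, D j k, ?_, ?_, fun x hx v => ?_⟩
  · refine MeasurableSet.iUnion fun j => MeasurableSet.iUnion fun k => ?_
    refine measurableSet_le measurable_const ?_
    have h1 : Measurable fun x : Fin m → Fin p → ℝ => ∑ i, truncMoment j k (x i) :=
      Finset.measurable_fun_sum _ fun i _ => (measurable_truncMoment j k).comp (measurable_pi_apply i)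
    exact (h1.sub_const _).abs
  · calc (Measure.pi fun _ : Fin m => ν) (⋃ j, ⋃ k, D j k)
        ≤ ∑ j, ∑ k, (Measure.pi fun _ : Fin m => ν) (D j k) :=
          (measure_iUnion_fintype_le _ _).trans
            (Finset.sum_le_sum fun j _ => measure_iUnion_fintype_le _ _)
      _ ≤ ∑ _ : Fin p, ∑ _ : Fin p, ENNReal.ofReal ((δ ^ 2)⁻¹ / m) :=
          Finset.sum_le_sum fun j _ => Finset.sum_le_sum fun k _ =>
            measure_truncMoment_deviation_le ν j k hδ0 hm
      _ = ENNReal.ofReal (p * p * ((δ ^ 2)⁻¹ / m)) := by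
          rw [ENNReal.ofReal_mul (by positivity), ENNReal.ofReal_mul (by positivity)]
          simp [mul_assoc]
      _ ≤ _ := by
          refine ENNReal.ofReal_le_ofReal ?_
          rw [mul_div_assoc]
          gcongr
          linarith
  · simp only [Set.mem_iUnion, not_exists] at hx
    have hdev : ∀ j k, |∑ i, truncMoment j k (x i) - m * ∫ y, truncMoment j k y ∂ν| ≤ δ * m :=
      fun j k => (not_le.1 (hx j k)).le
    -- Dividing by 1 + ‖x‖² only decreases the Gram form, so a lower bound for the truncated moments
    -- suffices.
    have h1 : ∑ i, (v ⬝ᵥ x i) ^ 2 / (1 + sqNorm (x i)) ≤ sqNorm (Matrix.of x *ᵥ v) := by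
      refine Finset.sum_le_sum fun i _ => ?_
      rw [show (Matrix.of x *ᵥ v) i = v ⬝ᵥ x i from dotProduct_comm _ _]
      exact div_le_self (sq_nonneg _) (by linarith [sqNorm_nonneg (x i)])
    have h2 : ∑ i, (v ⬝ᵥ x i) ^ 2 / (1 + sqNorm (x i)) =
        ∑ j, ∑ k, v j * v k * ∑ i, truncMoment j k (x i) := by
      simp only [← sum_sum_truncMoment, Finset.mul_sum]
      rw [Finset.sum_comm]
      exact Finset.sum_congr rfl fun j _ => Finset.sum_comm
    have h3 : ∀ j k, v j * v k * (m * ∫ y, truncMoment j k y ∂ν) - |v j| * |v k| * (δ * m) ≤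
        v j * v k * ∑ i, truncMoment j k (x i) := by
      intro j k
      have h4 : |v j * v k * (∑ i, truncMoment j k (x i) - m * ∫ y, truncMoment j k y ∂ν)| ≤
          |v j| * |v k| * (δ * m) := by
        rw [abs_mul, abs_mul]
        exact mul_le_mul_of_nonneg_left (hdev j k) (by positivity)
      have h5 := neg_le_of_abs_le h4
      rw [mul_sub] at h5
      linarith
    have h6 : ∑ j, ∑ k, |v j| * |v k| * (δ * m) ≤ p * sqNorm v * (δ * m) := by
      simp only [← Finset.sum_mul, ← Finset.mul_sum]
      refine mul_le_mul_of_nonneg_right ?_ (by positivity)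
      have := sq_sum_le_card_mul_sum_sq (s := (Finset.univ : Finset (Fin p))) (f := fun j => |v j|)
      simpa [sq_abs, ← sq, sqNorm] using this
    have h7 := Finset.sum_le_sum fun j (_ : j ∈ Finset.univ) =>
      Finset.sum_le_sum fun k (_ : k ∈ Finset.univ) => h3 j k
    simp only [Finset.sum_sub_distrib] at h7
    have h8 : ∑ j, ∑ k, v j * v k * (m * ∫ y, truncMoment j k y ∂ν) =
        m * ∑ j, ∑ k, v j * v k * ∫ y, truncMoment j k y ∂ν := by
      simp only [Finset.mul_sum]
      refine Finset.sum_congr rfl fun j _ => Finset.sum_congr rfl fun k _ => ?_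
      ring
    have h9 := mul_le_mul_of_nonneg_left (hcoer v) hm0.le
    have h10 : p * sqNorm v * (δ * m) ≤ c / 2 * m * sqNorm v := by
      have : p * δ ≤ c / 2 := by
        rw [hδ, mul_div_assoc', div_le_div_iff₀ (by positivity) (by positivity)]
        nlinarith
      have h11 := mul_le_mul_of_nonneg_right this (mul_nonneg hm0.le (sqNorm_nonneg v))
      linarith
    linarith

end WeakLaw

/-! ### Conditional risk given the observational data -/

section InterventionalRisk

variable {p n m : ℕ} {ε lam : ℝ}

/-- The squared error of the weighted estimator, as a function of the interventional noise. -/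
noncomputable def noiseError (ε lam : ℝ) (α : Fin p → ℝ) (XO : Matrix (Fin n) (Fin p) ℝ)
    (YO : Fin n → ℝ) (X : Matrix (Fin m) (Fin p) ℝ) (e : Fin m → ℝ) : ℝ≥0∞ :=
  ENNReal.ofReal (sqNorm
    (weighted (weightRidge ε lam XO YO X (X *ᵥ α + e)) XO YO X (X *ᵥ α + e) - α))

/-- Zero noise variance escapes the general bound, which involves s⁻¹; here the noise vanishes
almost surely and the estimator is exact. -/
theorem lintegral_noiseError_noiseless (hε : 0 < ε) (α : Fin p → ℝ)
    (XO : Matrix (Fin n) (Fin p) ℝ) (YO : Fin n → ℝ) {X : Matrix (Fin m) (Fin p) ℝ}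
    (hX : IsUnit (Xᵀ * X).det) :
    ∫⁻ e, noiseError ε lam α XO YO X e ∂(Measure.pi fun _ : Fin m => gaussianReal 0 0) = 0 := by
  have h0 : ∀ᵐ e ∂(Measure.pi fun _ : Fin m => gaussianReal 0 0), e = 0 := by
    have h1 : ∀ i : Fin m, ∀ᵐ e ∂(Measure.pi fun _ : Fin m => gaussianReal 0 0), e i = 0 := by
      intro i
      refine (measurePreserving_eval (fun _ : Fin m => gaussianReal 0 0) i).quasiMeasurePreserving.ae
        (p := fun y => y = 0) ?_
      rw [gaussianReal_zero_var]
      exact (ae_dirac_iff (measurableSet_singleton 0)).2 rfl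
    filter_upwards [ae_all_iff.2 h1] with e he
    exact funext he
  rw [← lintegral_zero (μ := Measure.pi fun _ : Fin m => gaussianReal 0 0)]
  refine lintegral_congr_ae ?_
  filter_upwards [h0] with e he
  rw [he, noiseError, add_zero, weighted_of_noiseless hε hX, sub_self, sqNorm_zero,
    ENNReal.ofReal_zero]

/-- For every design, the conditional risk given the observational data is bounded. -/
theorem exists_lintegral_noiseError_le (hε : 0 < ε) (hlam : 0 < lam) (α : Fin p → ℝ) (v : ℝ≥0) :
    ∃ K : ℝ≥0∞, K < ∞ ∧ ∀ {n m : ℕ} (XO : Matrix (Fin n) (Fin p) ℝ) (YO : Fin n → ℝ)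
      (X : Matrix (Fin m) (Fin p) ℝ) (θ : ℝ), 2 * p + 8 ≤ m → 1 ≤ θ →
      sqNorm (α - ols XO YO) ≤ θ → (∀ w, sqNorm (covHat XO YO *ᵥ w) ≤ θ ^ 2 * sqNorm w) →
      ∫⁻ e, noiseError ε lam α XO YO X e ∂(Measure.pi fun _ : Fin m => gaussianReal 0 v) ≤
        ENNReal.ofReal (θ ^ 3) * K := by
  obtain ⟨K₀, hK₀, hbound⟩ := exists_sqNorm_error_le p hε hlam
  obtain ⟨K₁, hK₁, hfit⟩ := exists_lintegral_fit_le p v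
  obtain ⟨K₂, hK₂, hinv⟩ : ∃ K : ℝ≥0∞, K < ∞ ∧ (v ≠ 0 → ∀ {m : ℕ} {X : Matrix (Fin m) (Fin p) ℝ},
      2 * p + 8 ≤ m → IsUnit (Xᵀ * X).det → ∫⁻ e, (ENNReal.ofReal (varHat X e))⁻¹ ^ 2
        ∂(Measure.pi fun _ : Fin m => gaussianReal 0 v) ≤ K) := by
    by_cases hv : v = 0
    · exact ⟨0, by simp, fun h => absurd hv h⟩
    · obtain ⟨K, hK, h⟩ := exists_lintegral_inv_varHat_le p hv
      exact ⟨K, hK, fun _ => h⟩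
  refine ⟨ENNReal.ofReal (sqNorm α) + ENNReal.ofReal K₀ * (K₁ + K₂), ENNReal.add_lt_top.2
    ⟨ENNReal.ofReal_lt_top, ENNReal.mul_lt_top ENNReal.ofReal_lt_top
      (ENNReal.add_lt_top.2 ⟨hK₁, hK₂⟩)⟩, fun {n m} XO YO X θ hm hθ hβ hC => ?_⟩
  have hθ3 : 1 ≤ θ ^ 3 := one_le_pow₀ hθ
  by_cases hX : IsUnit (Xᵀ * X).det
  swap
  · calc ∫⁻ e, noiseError ε lam α XO YO X e ∂(Measure.pi fun _ : Fin m => gaussianReal 0 v)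
        = ∫⁻ _, ENNReal.ofReal (sqNorm α) ∂(Measure.pi fun _ : Fin m => gaussianReal 0 v) := by
          refine lintegral_congr fun e => ?_
          rw [noiseError, weighted_of_not_isUnit hε hX, zero_sub, sqNorm_neg]
      _ = 1 * ENNReal.ofReal (sqNorm α) := by simp
      _ ≤ _ := mul_le_mul' (ENNReal.one_le_ofReal.2 hθ3) le_self_add
  by_cases hv : v = 0
  · subst hv
    rw [lintegral_noiseError_noiseless hε α XO YO hX]
    exact zero_le
  have hpt : ∀ e : Fin m → ℝ, noiseError ε lam α XO YO X e ≤ ENNReal.ofReal (θ ^ 3) *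
      (ENNReal.ofReal K₀ * (ENNReal.ofReal ((1 + sqNorm (X *ᵥ ols X e)) ^ 6) +
        (ENNReal.ofReal (varHat X e))⁻¹ ^ 2)) := by
    intro e
    -- If the residual variance is 0, its inverse is ∞ in `ℝ≥0∞` and the bound is trivial.
    rcases (varHat_nonneg X e).eq_or_lt with h0 | hs
    · rw [← h0, ENNReal.ofReal_zero, ENNReal.inv_zero, ENNReal.top_pow two_ne_zero, add_top,
        ENNReal.mul_top (by simpa using hK₀), ENNReal.mul_top (by simp; positivity)]
      exact le_top
    · have h1 := hbound XO YO X e α θ hX hθ hβ hC hs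
      have hG := sqNorm_nonneg (X *ᵥ ols X e)
      rw [← ENNReal.ofReal_inv_of_pos hs, ← ENNReal.ofReal_pow (by positivity),
        ← ENNReal.ofReal_add (by positivity) (by positivity), ← ENNReal.ofReal_mul hK₀.le,
        ← ENNReal.ofReal_mul (by positivity)]
      refine ENNReal.ofReal_le_ofReal (h1.trans (le_of_eq ?_))
      ring
  refine (lintegral_mono hpt).trans ?_
  have hmG := measurable_sqNorm_fit X
  rw [lintegral_const_mul' _ _ ENNReal.ofReal_ne_top, lintegral_const_mul' _ _ ENNReal.ofReal_ne_top,
    lintegral_add_left (by fun_prop)]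
  refine mul_le_mul_right (le_add_left (mul_le_mul_right (add_le_add (hfit hX) ?_) _)) _
  exact hinv hv hm hX

/-- For well-conditioned designs, the conditional risk given the observational data is small. -/
theorem exists_lintegral_noiseError_le_div (hε : 0 < ε) (α : Fin p → ℝ) (v : ℝ≥0) :
    ∃ K : ℝ≥0∞, K < ∞ ∧ ∀ {n m : ℕ} (XO : Matrix (Fin n) (Fin p) ℝ) (YO : Fin n → ℝ)
      (X : Matrix (Fin m) (Fin p) ℝ) (θ κ : ℝ), 2 ≤ m → 1 ≤ θ →
      sqNorm (α - ols XO YO) ≤ θ → 1 ≤ κ → (∀ w, κ * sqNorm w ≤ sqNorm (X *ᵥ w)) →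
      ∫⁻ e, noiseError ε lam α XO YO X e ∂(Measure.pi fun _ : Fin m => gaussianReal 0 v) ≤
        ENNReal.ofReal (θ ^ 3) * (ENNReal.ofReal κ⁻¹ * K) := by
  obtain ⟨K₁, hK₁, hfit⟩ := exists_lintegral_fit_le p v
  obtain ⟨K₂, hK₂, hvar⟩ := exists_lintegral_varHat_le p v
  refine ⟨ENNReal.ofReal (2 + 4 / ε ^ 2) * (K₁ + K₂), ENNReal.mul_lt_top ENNReal.ofReal_lt_top
    (ENNReal.add_lt_top.2 ⟨hK₁, hK₂⟩), fun {n m} XO YO X θ κ hm hθ hβ hκ hcond => ?_⟩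
  have hκ0 : 0 < κ := by linarith
  have hX : IsUnit (Xᵀ * X).det := isUnit_gram_of_forall_pos fun w hw => by
    have : 0 < sqNorm w := lt_of_le_of_ne (sqNorm_nonneg w) fun h => hw (sqNorm_eq_zero.1 h.symm)
    nlinarith [hcond w]
  have hpt : ∀ e : Fin m → ℝ, noiseError ε lam α XO YO X e ≤ ENNReal.ofReal (θ ^ 3) *
      (ENNReal.ofReal κ⁻¹ * (ENNReal.ofReal (2 + 4 / ε ^ 2) *
        (ENNReal.ofReal ((1 + sqNorm (X *ᵥ ols X e)) ^ 6) +
          ENNReal.ofReal (varHat X e ^ 4)))) := by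
    intro e
    have h1 := sqNorm_error_le_of_coercive_gram (lam := lam) (α := α) (XO := XO) (YO := YO) hε hκ
      hcond e hθ hβ
    have hG := sqNorm_nonneg (X *ᵥ ols X e)
    have hs := varHat_nonneg X e
    rw [← ENNReal.ofReal_add (by positivity) (by positivity),
      ← ENNReal.ofReal_mul (by positivity), ← ENNReal.ofReal_mul (by positivity),
      ← ENNReal.ofReal_mul (by positivity)]
    refine ENNReal.ofReal_le_ofReal (h1.trans ?_)
    have h2 : (1 + sqNorm (X *ᵥ ols X e)) ^ 2 ≤ (1 + sqNorm (X *ᵥ ols X e)) ^ 6 :=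
      pow_le_pow_right₀ (by linarith) (by norm_num)
    have h3 : θ ≤ θ ^ 3 := le_self_pow₀ hθ (by norm_num)
    calc (2 + 4 / ε ^ 2) / κ * θ * ((1 + sqNorm (X *ᵥ ols X e)) ^ 2 + varHat X e ^ 4)
        ≤ (2 + 4 / ε ^ 2) / κ * θ ^ 3 * ((1 + sqNorm (X *ᵥ ols X e)) ^ 6 + varHat X e ^ 4) := by
          gcongr
      _ = _ := by ring
  refine (lintegral_mono hpt).trans ?_
  have hmG := measurable_sqNorm_fit X
  rw [lintegral_const_mul' _ _ ENNReal.ofReal_ne_top, lintegral_const_mul' _ _ ENNReal.ofReal_ne_top,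
    lintegral_const_mul' _ _ ENNReal.ofReal_ne_top, lintegral_add_left (by fun_prop)]
  gcongr
  · exact hfit hX
  · exact hvar hm hX

/-- The risk over the interventional sample, given the observational data, is `O(1/m)`. -/
theorem exists_interventional_risk_le (hε : 0 < ε) (hlam : 0 < lam) (α : Fin p → ℝ) (v : ℝ≥0)
    (ν : Measure (Fin p → ℝ)) [IsProbabilityMeasure ν]
    (hν : ∀ v : Fin p → ℝ, v ≠ 0 → ¬ ∀ᵐ x ∂ν, v ⬝ᵥ x = 0) :
    ∃ K : ℝ≥0∞, K < ∞ ∧ ∃ m₀ : ℕ, ∀ {n m : ℕ} (XO : Matrix (Fin n) (Fin p) ℝ) (YO : Fin n → ℝ)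
      (θ : ℝ), m₀ ≤ m → 1 ≤ θ → sqNorm (α - ols XO YO) ≤ θ →
      (∀ w, sqNorm (covHat XO YO *ᵥ w) ≤ θ ^ 2 * sqNorm w) →
      ∫⁻ x, ∫⁻ e, noiseError ε lam α XO YO (Matrix.of x) e
        ∂(Measure.pi fun _ : Fin m => gaussianReal 0 v) ∂(Measure.pi fun _ : Fin m => ν) ≤
        ENNReal.ofReal (θ ^ 3) * (K * ENNReal.ofReal (m : ℝ)⁻¹) := by
  obtain ⟨K₁, hK₁, hall⟩ := exists_lintegral_noiseError_le (lam := lam) hε hlam α v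
  obtain ⟨K₂, hK₂, hgood⟩ := exists_lintegral_noiseError_le_div (lam := lam) hε α v
  obtain ⟨κ, hκ, C, hC, hB⟩ := exists_coercive_gram ν hν
  refine ⟨K₁ * ENNReal.ofReal C + ENNReal.ofReal κ⁻¹ * K₂, ENNReal.add_lt_top.2
    ⟨ENNReal.mul_lt_top hK₁ ENNReal.ofReal_lt_top, ENNReal.mul_lt_top ENNReal.ofReal_lt_top hK₂⟩,
    -- The first threshold serves the bound valid for every design, the second gives κm ≥ 1 for the
    -- well-conditioned ones.
    max (2 * p + 8) ⌈κ⁻¹⌉₊, fun {n m} XO YO θ hm hθ hβ hCO => ?_⟩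
  have hm1 : 2 * p + 8 ≤ m := (le_max_left _ _).trans hm
  have hm2 : κ⁻¹ ≤ m := Nat.ceil_le.1 ((le_max_right _ _).trans hm)
  have hm0 : (0 : ℝ) < m := by exact_mod_cast (by omega : 0 < m)
  have hκm : 1 ≤ κ * m := by
    have := mul_le_mul_of_nonneg_left hm2 hκ.le
    rwa [mul_inv_cancel₀ hκ.ne'] at this
  obtain ⟨B, hBm, hBμ, hBc⟩ := hB m (by omega)
  have hpt : ∀ x : Fin m → Fin p → ℝ, ∫⁻ e, noiseError ε lam α XO YO (Matrix.of x) e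
      ∂(Measure.pi fun _ : Fin m => gaussianReal 0 v) ≤ ENNReal.ofReal (θ ^ 3) *
      (B.indicator (fun _ => K₁) x + ENNReal.ofReal (κ * m)⁻¹ * K₂) := by
    intro x
    -- On the exceptional set a bounded risk is enough, because its probability is O(1/m); off it
    -- the risk itself is O(1/m).
    by_cases hx : x ∈ B
    · rw [Set.indicator_of_mem hx]
      exact (hall XO YO (Matrix.of x) θ hm1 hθ hβ hCO).trans (mul_le_mul_right le_self_add _)
    · rw [Set.indicator_of_notMem hx, zero_add]
      exact hgood XO YO (Matrix.of x) θ (κ * m) (by omega) hθ hβ hκm (hBc x hx)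
  refine (lintegral_mono hpt).trans ?_
  rw [lintegral_const_mul' _ _ ENNReal.ofReal_ne_top,
    lintegral_add_left (measurable_const.indicator hBm), lintegral_indicator_const hBm,
    lintegral_const, measure_univ, mul_one]
  refine mul_le_mul_right ?_ _
  rw [add_mul, mul_inv, ENNReal.ofReal_mul (by positivity)]
  refine add_le_add ?_ (le_of_eq (by ring))
  rw [mul_assoc, ← ENNReal.ofReal_mul hC.le, ← div_eq_mul_inv]
  gcongr

end InterventionalRisk

/-! ### The O(1/m) bound and the limit -/

namespace LinearGaussianSEM

variable {p d : ℕ} (M : LinearGaussianSEM p d)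

/-- Integrating first over the interventional sample gives θ³ times O(1/m); integrating over the
observational sample then uses the bound on E θ³, uniform in n. -/
theorem exists_mse_le (hobs : (M.covX + M.B * M.covZ * M.Bᵀ).PosDef)
    (ν : Measure (Fin p → ℝ)) [IsProbabilityMeasure ν]
    (hν : ∀ v : Fin p → ℝ, v ≠ 0 → ¬ ∀ᵐ x ∂ν, v ⬝ᵥ x = 0)
    {ε lam : ℝ} (hε : 0 < ε) (hlam : 0 < lam) :
    ∃ K : ℝ≥0∞, K < ∞ ∧ ∃ n₀ m₀ : ℕ, ∀ n m : ℕ, n₀ ≤ n → m₀ ≤ m →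
      M.mse ν (n := n) (m := m) (fun XO YO XI YI =>
        weighted (weightRidge ε lam XO YO XI YI) XO YO XI YI) ≤
        K * ENNReal.ofReal (m : ℝ)⁻¹ := by
  obtain ⟨K₁, hK₁, hO⟩ := M.exists_observational_envelope hobs
  obtain ⟨K₂, hK₂, m₀, hI⟩ := exists_interventional_risk_le hε hlam M.α M.noiseVar ν hν
  refine ⟨K₁ * (K₂ + 1), ENNReal.mul_lt_top hK₁ (ENNReal.add_lt_top.2 ⟨hK₂, ENNReal.one_lt_top⟩),
    8 * (p + 6) + 1, max m₀ 1, fun n m hn hm => ?_⟩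
  have hm0 : (0 : ℝ) < m := by exact_mod_cast (by omega : 0 < m)
  obtain ⟨Θ, hΘ, hθ⟩ := hO n hn
  -- The added 1 makes r nonzero, so that Θ s = ∞ yields the trivial bound ∞ and not ∞·0 = 0.
  set r := (K₂ + 1) * ENNReal.ofReal (m : ℝ)⁻¹ with hr
  have hr0 : r ≠ 0 := mul_ne_zero (by simp) (by simpa using (by omega : m ≠ 0))
  have hrt : r ≠ ∞ := ENNReal.mul_ne_top (by simp [hK₂.ne]) ENNReal.ofReal_ne_top
  have hinner : ∀ s : Fin n → (Fin p → ℝ) × ℝ, ∫⁻ t, ENNReal.ofReal (sqNorm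
      (weighted (weightRidge ε lam (design s) (outcomes s) (design t) (outcomes t)) (design s)
        (outcomes s) (design t) (outcomes t) - M.α)) ∂(Measure.pi fun _ : Fin m => M.intLaw ν) ≤
      Θ s * r := by
    intro s
    by_cases hs : Θ s = ∞
    · rw [hs, ENNReal.top_mul hr0]
      exact le_top
    obtain ⟨θ, hθ1, hβ, hC, hθΘ⟩ := hθ s hs
    refine (M.lintegral_pi_intLaw_le ν m _).trans ?_
    refine (hI (design s) (outcomes s) θ ((le_max_left _ _).trans hm) hθ1 hβ hC).trans ?_
    exact mul_le_mul' hθΘ (mul_le_mul_left le_self_add _)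
  rw [mse, dataLaw]
  refine (lintegral_prod_le _).trans ((lintegral_mono hinner).trans ?_)
  rw [lintegral_mul_const' _ _ hrt, mul_assoc]
  exact mul_le_mul_left hΘ _

end LinearGaussianSEM

end CausalShrinkage

theorem proposition4p4 {p d : ℕ} (M : CausalShrinkage.LinearGaussianSEM p d)
    -- the observational covariance matrix of `X` is non-singular
    (hobs : (M.covX + M.B * M.covZ * M.Bᵀ).PosDef)
    -- the randomized treatment does not live on a proper linear subspace
    (ν : Measure (Fin p → ℝ)) [IsProbabilityMeasure ν]
    (hν : ∀ v : Fin p → ℝ, v ≠ 0 → ¬ ∀ᵐ x ∂ν, v ⬝ᵥ x = 0)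
    (ε lam : ℝ) (hε : 0 < ε) (hlam : 0 < lam)
    (n : ℕ → ℕ) (c : ℝ) (hn : Tendsto n atTop atTop)
    (hc : Tendsto (fun m : ℕ => (n m : ℝ) / (m : ℝ)) atTop (𝓝 c)) :
    Tendsto (fun m : ℕ => M.mse ν (n := n m) (m := m) fun XO YO XI YI =>
        CausalShrinkage.weighted (CausalShrinkage.weightRidge ε lam XO YO XI YI) XO YO XI YI)
      atTop (𝓝 0) := by
  obtain ⟨K, hK, n₀, m₀, hbound⟩ := M.exists_mse_le hobs ν hν hε hlam
  have hlim : Tendsto (fun m : ℕ => K * ENNReal.ofReal (m : ℝ)⁻¹) atTop (𝓝 0) := by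
    have h1 : Tendsto (fun m : ℕ => ENNReal.ofReal (m : ℝ)⁻¹) atTop (𝓝 0) := by
      simpa using ENNReal.tendsto_ofReal tendsto_inv_atTop_nhds_zero_nat
    simpa using ENNReal.Tendsto.const_mul h1 (Or.inr hK.ne)
  refine tendsto_of_tendsto_of_tendsto_of_le_of_le' tendsto_const_nhds hlim
    (Eventually.of_forall fun _ => zero_le) ?_
  filter_upwards [hn.eventually_ge_atTop n₀, eventually_ge_atTop m₀] with m h1 h2
  exact hbound (n m) m h1 h2
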